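/- **Setting.** For integers $M,B\ge 0$ the floating-point format $(M,B)$ consists of $0$ and of the numbers $(-1)^{s_a}\cdot 1.a\cdot 2^{(-1)^{s_b}b}$ with sign bits $s_a,s_b$, an $M$-bit fraction $a$ and a $B$-bit integer $b$; it has $1+M+1+B$ bits of precision. Every sum, product and quotient of numbers of the format is computed exactly and then rounded to the nearest number of the format (ties towards $0$; numbers beyond the largest one go to the largest one). Sums of several numbers are evaluated from left to right. A one-layer, one-head softmax Transformer on $N$ tokens with value dimension $1$ consists of a position-dependent embedding of tokens in $\mathbb R^d$, matrices $W^Q,W^K\in\mathbb R^{d\times d_q}$, $W^V\in\mathbb R^{d\times 1}$ and an MLP $\mathbb R\to\mathbb R^d$ with one hidden layer and ReLU activations on the hidden and output nodes ($d\ge 1$, $d_q$ and the hidden width are arbitrary). With embedded tokens $X_1,\dots,X_N$ its $i$-th output is the MLP applied to $$\frac{\sum_j e^{s_{ij}}X_jW^V}{\sum_j e^{s_{ij}}},\qquad s_{ij}=\langle X_iW^Q,X_jW^K\rangle .$$ The exponentials are rounded to the format, and everything after them (each summand $(e^{s_{ij}}X_j)W^V$, both sums over $j$, the quotient, the MLP)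 is computed in the format, with the parameters rounded to it. The scores $s_{ij}$ are computed either exactly or in another arithmetic, as specified below. Let $p\ge 6$, $m=2p-1$ (so $p=\lceil m/2\rceil$), $L=\lceil\log_2 p\rceil$ and $n>4p$. Call integers $(t,e)$ admissible if $t+e=p+L$, $e>L+2$ and $t>2$. For $\mathbf y,\mathbf z\in\{0,1\}^m$, with bits of index larger than $m$ read as $0$, put $$u^1_{\mathbf y}=(y_1,\dots,y_{e-1}),\qquad u^2_{\mathbf y}=(y_{t+e-1},\dots,y_{t+2e-2-L}),$$ the latter filled up with zeros to length $e-1$. The input representation $\mathcal T^3_m(\mathbf y,\mathbf z)$ with parameters $(t,e)$ is the sequence of $n$ tokens in $\{0,1\}^{e-1}\times\{0,1\}$, indexed by $0,\dots,n-1$, whose tokens at indices $0,\dots,m-1$ are * index $0$: $(u^1_{\mathbf y},0)$; index $i$ for $1\le i\le t-1$: $(u^1_{\mathbf y},y_{e+i-1})$; * index $t-1+i$ for $1\le i\le t-1$: $(u^2_{\mathbf y},y_{t+2e-2-L+i})$; index $2t-1$: $(u^2_{\mathbf y},0)$; indices $2t,\dots,m-1$: zero; and the others are * index $m$: $(u^1_{\mathbf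 z},0)$; index $m+i$ for $1\le i\le t-1$: $(u^1_{\mathbf z},z_{e+i-1})$; * index $m+t-1+i$ for $1\le i\le t-1$: $(u^2_{\mathbf z},z_{t+2e-2-L+i})$; indices $m+2t-1,\dots,2m$: zero; index $2m+1$: $(u^2_{\mathbf z},0)$; all later indices: zero. A Transformer on $n+1$ tokens computes $\mathsf{EQ}_m$ in this representation if, on $\mathcal T^3_m(\mathbf y,\mathbf z)$ followed by a zero token, the first entry of its last output is $1$ when $\mathbf y=\mathbf z$ and $0$ when $\mathbf y\ne\mathbf z$, for all $\mathbf y,\mathbf z\in\{0,1\}^m$ such that $\mathbf y\le\mathbf z$ as binary numbers and $z_1\cdots z_e\ne 1\cdots 1$. **Theorem.** Let $p\ge 6$, $n>4p$ and $m=2p-1$. Admissible pairs $(t,e)$ exist, and for every admissible pair $(t,e)$, with the input representation $\mathcal T^3_m$ with parameters $(t,e)$: 1. No one-layer, one-head softmax Transformer with value dimension $1$ computes $\mathsf{EQ}_m$ in a floating-point format of at most $p-1$ bits, whether its scores are computed exactly, in the format, or in an arithmetic with any other rounding map. 2. There is a one-layer, one-head softmax Transformer with value dimension $1$ that computes $\mathsf{EQ}_m$,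 with exactly computed scores, in the format $(M,B)=(t-1,e-1)$, which has $p+\lceil\log_2 p\rceil$ bits (the sign bits being counted in $t$ and $e$); and there is one that does so in the format $(M,B)=(t,e)$, which has $p+\lceil\log_2 p\rceil+2$ bits (the sign bits being counted in addition). -/

import Mathlib

namespace FPTransformer

/-- A floating-point format: `M` bits `a` of mantissa (the mantissa is `1.a`) and `B` bits `b` of
exponent, each with one additional sign bit. -/
structure Format where
  M : ℕ
  B : ℕ

namespace Format

/-- The number of bits of precision, `1 + |a| + 1 + |b|`. -/
def bits (F : Format) : ℕ := 1 + F.M + 1 + F.B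

/-- The value `(-1)^{s_a} * 1.a * 2^{(-1)^{s_b} * b}`. -/
noncomputable def value (F : Format) (sa : Bool) (a : Fin (2 ^ F.M)) (sb : Bool)
    (b : Fin (2 ^ F.B)) : ℝ :=
  (if sa then -1 else 1) * (1 + (a : ℝ) / 2 ^ F.M) *
    (2 : ℝ) ^ (if sb then -((b : ℕ) : ℤ) else ((b : ℕ) : ℤ))

/-- The permissible numbers of the format: the values of the quadruples, and zero. -/
def permissible (F : Format) : Set ℝ :=
  insert 0 {x | ∃ sa a sb b, x = F.value sa a sb b}

/-- `r` is the permissible number nearest to `x`; a tie is broken by truncation, i.e. in favour of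
the number of smaller absolute value. -/
def IsRounding (F : Format) (x r : ℝ) : Prop :=
  r ∈ F.permissible ∧
    ∀ s ∈ F.permissible, |x - r| < |x - s| ∨ (|x - r| = |x - s| ∧ |r| ≤ |s|)

theorem permissible_finite (F : Format) : F.permissible.Finite := by
  refine Set.Finite.insert 0 ?_
  refine (Set.finite_range
    (fun q : Bool × Fin (2 ^ F.M) × Bool × Fin (2 ^ F.B) =>
      F.value q.1 q.2.1 q.2.2.1 q.2.2.2)).subset ?_
  rintro x ⟨sa, a, sb, b, rfl⟩
  exact ⟨(sa, a, sb, b), rfl⟩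

theorem exists_isRounding (F : Format) (x : ℝ) : ∃ r, F.IsRounding x r := by
  obtain ⟨r, hr, hmin⟩ := Set.exists_min_image F.permissible
    (fun s => toLex (|x - s|, |s|)) F.permissible_finite ⟨0, Set.mem_insert _ _⟩
  refine ⟨r, hr, fun s hs => ?_⟩
  simpa [Prod.Lex.le_iff] using hmin s hs

theorem isRounding_unique (F : Format) {x r s : ℝ} (hr : F.IsRounding x r)
    (hs : F.IsRounding x s) : r = s := by
  have h1 := hr.2 s hs.1
  have h2 := hs.2 r hr.1
  have hd : |x - r| = |x - s| := by
    rcases h1 with h | h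
    · rcases h2 with h' | h'
      · linarith
      · linarith [h'.1]
    · exact h.1
  have ha : |r| = |s| := by
    rcases h1 with h | h
    · linarith
    · rcases h2 with h' | h'
      · linarith
      · exact le_antisymm h.2 h'.2
  rcases abs_eq_abs.mp ha with h | h
  · exact h
  · rcases abs_eq_abs.mp hd with h' | h'
    · linarith
    · have hx : x = 0 := by linarith
      have h0 := hr.2 0 (Set.mem_insert _ _)
      rw [hx] at h0
      have hr0 : |r| = 0 := by
        have := abs_nonneg r
        simp only [zero_sub, abs_neg, neg_zero, abs_zero] at h0
        rcases h0 with h0 | h0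
        · linarith
        · exact h0.1
      have := abs_eq_zero.mp hr0
      linarith

/-- Rounding to the format. -/
noncomputable def round (F : Format) (x : ℝ) : ℝ := (F.exists_isRounding x).choose

theorem round_spec (F : Format) (x : ℝ) : F.IsRounding x (F.round x) :=
  (F.exists_isRounding x).choose_spec

end Format

/-! Arithmetic relative to a rounding map `ρ`: the operands are stored in the format, the exact
result is computed, and then rounded. The choice `ρ = id` is exact arithmetic. -/

/-- Multiplication of two numbers. -/
def mul (ρ : ℝ → ℝ) (x y : ℝ) : ℝ := ρ (ρ x * ρ y)

/-- Addition of two numbers. -/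
def add (ρ : ℝ → ℝ) (x y : ℝ) : ℝ := ρ (ρ x + ρ y)

/-- The left-associative sum `((x₁ + x₂) + x₃) + ⋯ + xₖ`. -/
def lsum (ρ : ℝ → ℝ) {k : ℕ} (x : Fin k → ℝ) : ℝ := (List.ofFn x).foldl (add ρ) 0

/-- The inner product, with a left-associative sum. -/
def dot (ρ : ℝ → ℝ) {k : ℕ} (u v : Fin k → ℝ) : ℝ := lsum ρ fun a => mul ρ (u a) (v a)

/-- The parameters of a one-layer, one-head softmax Transformer on `N` tokens over the alphabet
`A`, with embedding dimension `d`, query dimension `dq`, value dimension `dv` and `dff` hidden nodes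
in the MLP. The embedding may depend on the position of the token. -/
structure Transformer (N : ℕ) (A : Type) (d dq dv dff : ℕ) where
  embed : Fin N → A → Fin d → ℝ
  WQ : Fin d → Fin dq → ℝ
  WK : Fin d → Fin dq → ℝ
  WV : Fin d → Fin dv → ℝ
  w1 : Fin dv → Fin dff → ℝ
  b1 : Fin dff → ℝ
  w2 : Fin dff → Fin d → ℝ
  b2 : Fin d → ℝ

namespace Transformer

variable {N : ℕ} {A : Type} {d dq dv dff : ℕ}

/-- The score `⟨Q_i, K_j⟩` with `Q = X W^Q` and `K = X W^K`; `σ` is the rounding map of the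
arithmetic in which the scores are computed. -/
def score (T : Transformer N A d dq dv dff) (σ : ℝ → ℝ) (x : Fin N → A) (i j : Fin N) : ℝ :=
  dot σ (fun k => dot σ (T.embed i (x i)) fun a => T.WQ a k)
    (fun k => dot σ (T.embed j (x j)) fun a => T.WK a k)

/-- The attention weight `e^{⟨Q_i, K_j⟩}` in the format `F`. -/
noncomputable def weight (T : Transformer N A d dq dv dff) (F : Format) (σ : ℝ → ℝ)
    (x : Fin N → A) (i j : Fin N) : ℝ :=
  F.round (Real.exp (T.score σ x i j))

/-- The numerator `∑_j e^{⟨Q_i, K_j⟩} X_j W^V`: each summand is multiplied from left to right, and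
the summands are added from left to right. -/
noncomputable def numerator (T : Transformer N A d dq dv dff) (F : Format) (σ : ℝ → ℝ)
    (x : Fin N → A) (i : Fin N) (c : Fin dv) : ℝ :=
  lsum F.round fun j =>
    dot F.round (fun a => mul F.round (T.weight F σ x i j) (T.embed j (x j) a)) fun a => T.WV a c

/-- The denominator `∑_j e^{⟨Q_i, K_j⟩}`. -/
noncomputable def denominator (T : Transformer N A d dq dv dff) (F : Format) (σ : ℝ → ℝ)
    (x : Fin N → A) (i : Fin N) : ℝ :=
  lsum F.round fun j => T.weight F σ x i j

/-- Softmax self-attention in the format `F`. -/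
noncomputable def attention (T : Transformer N A d dq dv dff) (F : Format) (σ : ℝ → ℝ)
    (x : Fin N → A) (i : Fin N) (c : Fin dv) : ℝ :=
  F.round (T.numerator F σ x i c / T.denominator F σ x i)

/-- The MLP layer with one hidden layer and ReLU activations, in the format `F`. -/
noncomputable def mlp (T : Transformer N A d dq dv dff) (F : Format) (v : Fin dv → ℝ) :
    Fin d → ℝ :=
  fun k => max 0 (add F.round
    (dot F.round
      (fun j => max 0 (add F.round (dot F.round v fun c => T.w1 c j) (T.b1 j)))
      (fun j => T.w2 j k))
    (T.b2 k))

/-- The `i`-th output row. -/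
noncomputable def output (T : Transformer N A d dq dv dff) (F : Format) (σ : ℝ → ℝ)
    (x : Fin N → A) (i : Fin N) : Fin d → ℝ :=
  T.mlp F (T.attention F σ x i)

end Transformer

/-- The number whose binary expression is `y₁ y₂ … y_m` (here `y i` is the bit `y_{i+1}`). -/
def binVal {m : ℕ} (y : Fin m → Bool) : ℕ :=
  ∑ i : Fin m, if y i then 2 ^ (m - 1 - (i : ℕ)) else 0

/-- The bit `y_i` for `1 ≤ i ≤ m`, and `0` for an index outside of this range. -/
def bit {m : ℕ} (y : Fin m → Bool) (i : ℕ) : Bool :=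
  if h : 1 ≤ i ∧ i ≤ m then y ⟨i - 1, by omega⟩ else false

/-- A token: a tuple of `e - 1` bits, and one more bit. -/
abbrev Token (e : ℕ) : Type := (Fin (e - 1) → Bool) × Bool

/-- The token that consists of zeros; it is also the placeholder in the last position. -/
def zeroToken (e : ℕ) : Token e := (fun _ => false, false)

/-- `log ⌈m/2⌉`, rounded up to an integer. -/
def lg (m : ℕ) : ℕ := Nat.clog 2 ((m + 1) / 2)

/-- The tuple `(y_1, …, y_{e-1})`. -/
def tuple₁ {m : ℕ} (e : ℕ) (y : Fin m → Bool) : Fin (e - 1) → Bool := fun k => bit y (k + 1)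

/-- The tuple `(y_{t+e-1}, …, y_{t+2e-2-log ⌈m/2⌉})` of `e - log ⌈m/2⌉` bits, filled up with zeros
to the length `e - 1`. -/
def tuple₂ {m : ℕ} (t e : ℕ) (y : Fin m → Bool) : Fin (e - 1) → Bool :=
  fun k => if (k : ℕ) < e - lg m then bit y (t + e - 1 + k) else false

/-- The input representation, with tokens indexed from `0` to `n - 1`. -/
def inputRep {m : ℕ} (n t e : ℕ) (y z : Fin m → Bool) (i : Fin n) : Token e :=
  if (i : ℕ) = 0 then (tuple₁ e y, false)
  else if (i : ℕ) ≤ t - 1 then (tuple₁ e y, bit y (e + i - 1))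
  else if (i : ℕ) ≤ 2 * t - 2 then
    (tuple₂ t e y, bit y (t + 2 * e - 2 - lg m + (i - (t - 1))))
  else if (i : ℕ) = 2 * t - 1 then (tuple₂ t e y, false)
  else if (i : ℕ) ≤ m - 1 then zeroToken e
  else if (i : ℕ) = m then (tuple₁ e z, false)
  else if (i : ℕ) ≤ m + (t - 1) then (tuple₁ e z, bit z (e + (i - m) - 1))
  else if (i : ℕ) ≤ m + (2 * t - 2) then
    (tuple₂ t e z, bit z (t + 2 * e - 2 - lg m + (i - (m + (t - 1)))))
  else if (i : ℕ) ≤ 2 * m then zeroToken e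
  else if (i : ℕ) = 2 * m + 1 then (tuple₂ t e z, false)
  else zeroToken e

/-- The promise on the inputs: `y ≤ z` as binary numbers, and `z_1 … z_e` is not `1 … 1`. -/
def Promise {m : ℕ} (e : ℕ) (y z : Fin m → Bool) : Prop :=
  binVal y ≤ binVal z ∧ ∃ i, 1 ≤ i ∧ i ≤ e ∧ bit z i = false

/-- The Transformer on `n + 1` tokens, with the format `F` and with scores computed in the arithmetic
of `σ`, computes equality of `m`-bit strings in the input representation with parameters `(t, e)`:
on the `n` tokens of the representation followed by the placeholder, the first entry of the last
output row is `1` if `y = z` and `0` otherwise, for all inputs that satisfy the promise. -/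
def ComputesEQ (m n t e : ℕ) {d dq dv dff : ℕ} (hd : 0 < d)
    (T : Transformer (n + 1) (Token e) d dq dv dff) (F : Format) (σ : ℝ → ℝ) : Prop :=
  ∀ y z : Fin m → Bool, Promise e y z →
    T.output F σ (Fin.snoc (inputRep n t e y z) (zeroToken e)) (Fin.last n) ⟨0, hd⟩ =
      if y = z then 1 else 0

/-- The conditions on the parameters `(t, e)` for strings of length `m`. -/
def Admissible (m t e : ℕ) : Prop :=
  t + e = (m + 1) / 2 + lg m ∧ lg m + 2 < e ∧ 2 < t

end FPTransformer

/-!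
Lower bound: the left-to-right sums of the numerators and of the denominator are the only memory of
the attention head. After the tokens of `y` they take fewer values than there are strings that
start with `0`, so two such strings `y < z` leave the same partial sums, and the output on `(y, z)`
is the output on `(z, z)`.

Upper bound: a string is cut into an upper and a lower half, and each half is read as a float whose
first bits are the exponent and whose remaining bits are the fraction. A token contributes either
the leading part of such a float or a single bit of its fraction, so that the accumulators add up
the floats exactly. The numerator receives the upper half of `y` with a negative sign, the upper
half of `z`, and the lower half of `z`; the denominator receives the lower half of `y`, at a scale
at which the remaining weights `2 ^ A` are rounded away. For equal upper halves the numerator is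
`2 ^ γ` times the lower half of `z`, so the quotient is `2 ^ γ` for equal strings and differs from
it by a relative error of at least `2 ^ (-M)` for different ones. If the upper halves differ, then
their difference, which is positive because `y ≤ z`, makes the quotient at least `2 * 2 ^ γ`. The
MLP maps `2 ^ γ` to `1` and the other quotients to `0`.
-/

namespace FPTransformer

namespace Format

variable (F : Format)

/-- The largest exponent of a number of the format. -/
def emax : ℤ := 2 ^ F.B - 1

theorem emax_nonneg : 0 ≤ F.emax :=
  sub_nonneg.2 (one_le_pow₀ one_le_two)

theorem zero_mem : (0 : ℝ) ∈ F.permissible := Set.mem_insert _ _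

theorem neg_mem {x : ℝ} (hx : x ∈ F.permissible) : -x ∈ F.permissible := by
  rcases hx with rfl | ⟨sa, a, sb, b, rfl⟩
  · simpa only [neg_zero] using F.zero_mem
  · refine Or.inr ⟨!sa, a, sb, b, ?_⟩
    cases sa <;>
      simp only [value, Bool.not_true, Bool.not_false, if_true, if_false, Bool.false_eq_true] <;>
      ring

theorem round_mem (x : ℝ) : F.round x ∈ F.permissible := (F.round_spec x).1

theorem max_zero_round_mem (x : ℝ) : max 0 (F.round x) ∈ F.permissible := by
  rcases max_choice 0 (F.round x) with h | h <;> rw [h]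
  exacts [F.zero_mem, F.round_mem x]

theorem abs_sub_round_le (x : ℝ) {s : ℝ} (hs : s ∈ F.permissible) :
    |x - F.round x| ≤ |x - s| :=
  ((F.round_spec x).2 s hs).elim le_of_lt fun h => h.1.le

theorem round_eq_self {x : ℝ} (hx : x ∈ F.permissible) : F.round x = x := by
  have h := F.abs_sub_round_le x hx
  rw [sub_self, abs_zero, abs_nonpos_iff] at h
  linarith

theorem le_round {a x : ℝ} (ha : a ∈ F.permissible) (h : a ≤ x) : a ≤ F.round x := by
  by_contra! hlt
  have hdist := F.abs_sub_round_le x ha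
  rw [abs_of_nonneg (by linarith), abs_of_nonneg (by linarith)] at hdist
  linarith

theorem round_le {a x : ℝ} (ha : a ∈ F.permissible) (h : x ≤ a) : F.round x ≤ a := by
  by_contra! hlt
  have hdist := F.abs_sub_round_le x ha
  rw [abs_of_nonpos (by linarith), abs_of_nonpos (by linarith)] at hdist
  linarith

theorem round_nonneg {x : ℝ} (h : 0 ≤ x) : 0 ≤ F.round x := F.le_round F.zero_mem h

theorem round_nonpos {x : ℝ} (h : x ≤ 0) : F.round x ≤ 0 := F.round_le F.zero_mem h

@[simp]
theorem round_zero : F.round 0 = 0 := F.round_eq_self F.zero_mem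

theorem add_eq_round {x y : ℝ} (hx : x ∈ F.permissible) (hy : y ∈ F.permissible) :
    add F.round x y = F.round (x + y) := by
  rw [add, F.round_eq_self hx, F.round_eq_self hy]

theorem add_eq_of_mem {x y : ℝ} (hx : x ∈ F.permissible) (hy : y ∈ F.permissible)
    (hxy : x + y ∈ F.permissible) : add F.round x y = x + y := by
  rw [F.add_eq_round hx hy, F.round_eq_self hxy]

theorem zero_add_eq {x : ℝ} (hx : x ∈ F.permissible) : add F.round 0 x = x := by
  rw [F.add_eq_round F.zero_mem hx, zero_add, F.round_eq_self hx]

theorem add_zero_eq {x : ℝ} (hx : x ∈ F.permissible) : add F.round x 0 = x := by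
  rw [F.add_eq_round hx F.zero_mem, add_zero, F.round_eq_self hx]

theorem mul_eq_round {x y : ℝ} (hx : x ∈ F.permissible) (hy : y ∈ F.permissible) :
    mul F.round x y = F.round (x * y) := by
  rw [mul, F.round_eq_self hx, F.round_eq_self hy]

theorem normalized_mem {n : ℕ} {k : ℤ} (hn : 2 ^ F.M ≤ n) (hn' : n < 2 ^ (F.M + 1))
    (hk : -F.emax ≤ k + F.M) (hk' : k + F.M ≤ F.emax) :
    (n : ℝ) * (2 : ℝ) ^ k ∈ F.permissible := by
  obtain ⟨a, rfl⟩ := Nat.exists_eq_add_of_le hn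
  have ha : a < 2 ^ F.M := by rw [pow_succ] at hn'; omega
  have hb : (k + F.M).natAbs < 2 ^ F.B := by
    unfold emax at hk hk'
    zify
    exact abs_lt.2 ⟨by omega, by omega⟩
  refine Or.inr ⟨false, ⟨a, ha⟩, decide (k + F.M < 0), ⟨(k + F.M).natAbs, hb⟩, ?_⟩
  have hexp : (if decide (k + F.M < 0) = true then -(((k + F.M).natAbs : ℕ) : ℤ)
      else (((k + F.M).natAbs : ℕ) : ℤ)) = k + F.M := by
    simp only [decide_eq_true_eq]; split_ifs <;> omega
  simp only [value, hexp, Bool.false_eq_true, if_false, one_mul]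
  rw [zpow_add₀ two_ne_zero, zpow_natCast]
  push_cast
  field_simp

theorem exists_normalized {s : ℝ} (hs : s ∈ F.permissible) (hpos : 0 < s) :
    ∃ (n : ℕ) (k : ℤ), 2 ^ F.M ≤ n ∧ n < 2 ^ (F.M + 1) ∧ s = (n : ℝ) * (2 : ℝ) ^ k := by
  rcases hs with rfl | ⟨sa, a, sb, b, rfl⟩
  · exact absurd hpos (lt_irrefl _)
  have habs : 0 < (1 + ((a : ℕ) : ℝ) / 2 ^ F.M) *
      (2 : ℝ) ^ (if sb then -((b : ℕ) : ℤ) else ((b : ℕ) : ℤ)) := by positivity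
  rw [value, mul_assoc] at hpos ⊢
  cases sa
  · refine ⟨2 ^ F.M + a, (if sb then -((b : ℕ) : ℤ) else ((b : ℕ) : ℤ)) - F.M, by omega,
      by have := a.2; rw [pow_succ]; omega, ?_⟩
    rw [zpow_sub₀ two_ne_zero, zpow_natCast, if_neg Bool.false_ne_true, one_mul]
    push_cast
    field_simp
  · rw [if_pos rfl] at hpos
    linarith

theorem natCast_mul_zpow_mem {q n : ℕ} {k : ℤ} (hq : q ≤ F.M) (hn : n < 2 ^ (q + 1))
    (hk : -F.emax ≤ k) (hk' : k + q ≤ F.emax) : (n : ℝ) * (2 : ℝ) ^ k ∈ F.permissible := by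
  rcases Nat.eq_zero_or_pos n with rfl | hpos
  · simpa only [Nat.cast_zero, zero_mul] using F.zero_mem
  have hlow : 2 ^ Nat.log 2 n ≤ n := Nat.pow_log_le_self 2 hpos.ne'
  have hhigh : n < 2 ^ (Nat.log 2 n + 1) := Nat.lt_pow_succ_log_self one_lt_two n
  have hlog : Nat.log 2 n ≤ q := Nat.lt_succ_iff.1 (Nat.log_lt_of_lt_pow hpos.ne' hn)
  obtain ⟨r, hr⟩ := Nat.exists_eq_add_of_le (hlog.trans hq)
  have hshift : (n : ℝ) * (2 : ℝ) ^ k = ((n * 2 ^ r : ℕ) : ℝ) * (2 : ℝ) ^ (k - r) := by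
    rw [zpow_sub₀ two_ne_zero, zpow_natCast]
    push_cast
    field_simp
  rw [hshift]
  refine F.normalized_mem ?_ ?_ (by omega) (by omega)
  · rw [hr, pow_add]
    gcongr
  · rw [hr, add_right_comm, pow_add _ _ r]
    gcongr

theorem intCast_mul_zpow_mem {q : ℕ} {n k : ℤ} (hq : q ≤ F.M) (hn : |n| < 2 ^ (q + 1))
    (hk : -F.emax ≤ k) (hk' : k + q ≤ F.emax) : (n : ℝ) * (2 : ℝ) ^ k ∈ F.permissible := by
  obtain ⟨l, rfl | rfl⟩ := n.eq_nat_or_neg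
  · exact_mod_cast F.natCast_mul_zpow_mem hq (by rw [Nat.abs_cast] at hn; exact_mod_cast hn) hk hk'
  · rw [abs_neg, Nat.abs_cast] at hn
    push_cast
    rw [neg_mul]
    exact F.neg_mem (F.natCast_mul_zpow_mem hq (by exact_mod_cast hn) hk hk')

theorem zpow_mem {k : ℤ} (hk : -F.emax ≤ k) (hk' : k ≤ F.emax) :
    (2 : ℝ) ^ k ∈ F.permissible := by
  simpa using F.natCast_mul_zpow_mem (q := 0) (n := 1) (Nat.zero_le _) (by norm_num) hk
    (by simpa using hk')

theorem one_mem : (1 : ℝ) ∈ F.permissible := by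
  have := F.emax_nonneg
  simpa only [zpow_zero] using F.zpow_mem (k := 0) (by omega) (by omega)

theorem add_zpow_le_of_lt {n : ℕ} {k : ℤ} {s : ℝ} (hn : 2 ^ F.M ≤ n) (hs : s ∈ F.permissible)
    (hlt : (n : ℝ) * (2 : ℝ) ^ k < s) : (n : ℝ) * (2 : ℝ) ^ k + (2 : ℝ) ^ k ≤ s := by
  obtain ⟨n', k', -, hn', rfl⟩ := F.exists_normalized hs (lt_of_le_of_lt (by positivity) hlt)
  rcases le_or_gt k k' with hk | hk
  · obtain ⟨j, rfl⟩ := Int.le.dest hk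
    have hscale : (n' : ℝ) * (2 : ℝ) ^ (k + j) = ((n' * 2 ^ j : ℕ) : ℝ) * (2 : ℝ) ^ k := by
      rw [zpow_add₀ two_ne_zero, zpow_natCast]; push_cast; ring
    rw [hscale] at hlt ⊢
    have hnat : n + 1 ≤ n' * 2 ^ j := by
      exact_mod_cast lt_of_mul_lt_mul_right hlt (by positivity : (0 : ℝ) ≤ (2 : ℝ) ^ k)
    calc (n : ℝ) * (2 : ℝ) ^ k + (2 : ℝ) ^ k = ((n + 1 : ℕ) : ℝ) * (2 : ℝ) ^ k := by
          push_cast; ring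
      _ ≤ _ := by gcongr
  · refine absurd hlt (not_lt.2 ?_)
    calc (n' : ℝ) * (2 : ℝ) ^ k' ≤ ((2 ^ (F.M + 1) : ℕ) : ℝ) * (2 : ℝ) ^ k' := by gcongr
      _ = ((2 ^ F.M : ℕ) : ℝ) * (2 : ℝ) ^ (k' + 1) := by
        rw [zpow_add_one₀ two_ne_zero]; push_cast; ring
      _ ≤ n * (2 : ℝ) ^ k := by
        gcongr
        · exact one_le_two
        · omega

/-- Half a unit in the last place is absorbed: ties are rounded towards zero. -/
theorem round_add_of_le_half_ulp {n : ℕ} {k : ℤ} {δ : ℝ} (hn : 2 ^ F.M ≤ n)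
    (hn' : n < 2 ^ (F.M + 1)) (hk : -F.emax ≤ k + F.M) (hk' : k + F.M ≤ F.emax) (hδ : 0 ≤ δ)
    (hδ' : δ ≤ (2 : ℝ) ^ (k - 1)) :
    F.round ((n : ℝ) * (2 : ℝ) ^ k + δ) = (n : ℝ) * (2 : ℝ) ^ k := by
  refine F.isRounding_unique (F.round_spec _) ⟨F.normalized_mem hn hn' hk hk', fun s hs => ?_⟩
  have hx : 0 ≤ (n : ℝ) * (2 : ℝ) ^ k := by positivity
  have hulp := F.add_zpow_le_of_lt (k := k) hn hs
  rw [zpow_sub_one₀ two_ne_zero] at hδ'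
  set x := (n : ℝ) * (2 : ℝ) ^ k
  rw [add_sub_cancel_left, abs_of_nonneg hδ]
  rcases lt_trichotomy s x with hlt | rfl | hgt
  · exact Or.inl (by rw [abs_of_pos (by linarith)]; linarith)
  · exact Or.inr ⟨by rw [add_sub_cancel_left, abs_of_nonneg hδ], le_rfl⟩
  · have hfar := hulp hgt
    rw [abs_of_nonpos (by linarith : x + δ - s ≤ 0), abs_of_nonneg hx, abs_of_pos (by linarith)]
    rcases lt_or_eq_of_le (by linarith : δ ≤ -(x + δ - s)) with h | h
    exacts [Or.inl h, Or.inr ⟨h, hgt.le⟩]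

/-- The exponent `0` has two encodings, which makes room for the number `0`. -/
theorem ncard_permissible_lt : F.permissible.ncard < 2 ^ F.bits := by
  set encodings := (Finset.univ : Finset Bool) ×ˢ (Finset.range (2 ^ F.M) ×ˢ
    Finset.Icc (-F.emax) F.emax)
  set decode : Bool × ℕ × ℤ → ℝ := fun x =>
    (if x.1 then -1 else 1) * (1 + (x.2.1 : ℝ) / 2 ^ F.M) * (2 : ℝ) ^ x.2.2
  have hsub : F.permissible ⊆ ↑(insert 0 (encodings.image decode)) := by
    rintro x (rfl | ⟨sa, a, sb, b, rfl⟩)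
    · exact Finset.mem_insert_self _ _
    · refine Finset.mem_insert_of_mem (Finset.mem_image.2
        ⟨(sa, a, if sb then -((b : ℕ) : ℤ) else ((b : ℕ) : ℤ)), ?_, rfl⟩)
      have hb : ((b : ℕ) : ℤ) < 2 ^ F.B := by exact_mod_cast b.2
      simp only [encodings, Finset.mem_product, Finset.mem_univ, Finset.mem_range,
        Finset.mem_Icc, true_and, emax]
      exact ⟨a.2, by split_ifs <;> omega⟩
  have hexps : (Finset.Icc (-F.emax) F.emax).card + 1 = 2 * 2 ^ F.B := by
    have hcast : (2 : ℤ) ^ F.B = ((2 ^ F.B : ℕ) : ℤ) := by push_cast; rfl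
    have := Nat.one_le_two_pow (n := F.B)
    rw [Int.card_Icc, emax, hcast]
    omega
  have hcard : encodings.card + 2 * 2 ^ F.M = 2 ^ F.bits := by
    rw [Finset.card_product, Finset.card_product, Finset.card_univ, Fintype.card_bool,
      Finset.card_range, ← mul_assoc, ← Nat.mul_succ, Nat.succ_eq_add_one, hexps, bits]
    ring
  calc F.permissible.ncard ≤ (insert 0 (encodings.image decode)).card := by
        rw [← Set.ncard_coe_finset]; exact Set.ncard_le_ncard hsub (Finset.finite_toSet _)
    _ ≤ encodings.card + 1 :=
        (Finset.card_insert_le _ _).trans (Nat.add_le_add_right Finset.card_image_le 1)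
    _ < 2 ^ F.bits := by
        have := Nat.one_le_two_pow (n := F.M)
        omega

end Format

section LowerBound

theorem lsum_mem (F : Format) {k : ℕ} (x : Fin k → ℝ) : lsum F.round x ∈ F.permissible := by
  cases k with
  | zero => simpa only [lsum, List.ofFn_zero, List.foldl_nil] using F.zero_mem
  | succ k =>
    rw [lsum, List.ofFn_succ_last, List.foldl_append]
    exact F.round_mem _

theorem lsum_add (ρ : ℝ → ℝ) {k l : ℕ} (x : Fin (k + l) → ℝ) :
    lsum ρ x = (List.ofFn fun j => x (Fin.natAdd k j)).foldl (add ρ)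
      (lsum ρ fun j => x (Fin.castAdd l j)) := by
  rw [lsum, List.ofFn_add, List.foldl_append]
  rfl

theorem lsum_eq_of_prefix_eq {ρ : ℝ → ℝ} {N k : ℕ} (hk : k ≤ N) {x x' : Fin N → ℝ}
    (hprefix : (lsum ρ fun j => x (Fin.castLE hk j)) = lsum ρ fun j => x' (Fin.castLE hk j))
    (hsuffix : ∀ j : Fin N, k ≤ (j : ℕ) → x j = x' j) : lsum ρ x = lsum ρ x' := by
  obtain ⟨l, rfl⟩ := Nat.exists_eq_add_of_le hk
  rw [lsum_add, lsum_add]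
  congr 1
  exact congrArg List.ofFn (funext fun j => hsuffix _ (Nat.le_add_right k j))

namespace Transformer

variable {N : ℕ} {A : Type} {d dq dv dff : ℕ} (T : Transformer N A d dq dv dff) (F : Format)
  (σ : ℝ → ℝ)

/-- The contribution of token `j` to the entry `c` of the numerator. -/
noncomputable def summand (x : Fin N → A) (i : Fin N) (c : Fin dv) (j : Fin N) : ℝ :=
  dot F.round (fun a => mul F.round (T.weight F σ x i j) (T.embed j (x j) a)) fun a => T.WV a c

/-- The memory of the attention head after the first `k` tokens: the partial sums of the numerators
and of the denominator. -/
noncomputable def prefixState (x : Fin N → A) (i : Fin N) {k : ℕ} (hk : k ≤ N) :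
    (Fin dv → ℝ) × ℝ :=
  (fun c => lsum F.round fun j => T.summand F σ x i c (Fin.castLE hk j),
    lsum F.round fun j => T.weight F σ x i (Fin.castLE hk j))

variable {T F σ} {x x' : Fin N → A} {i j : Fin N}

theorem weight_congr (hi : x i = x' i) (hj : x j = x' j) :
    T.weight F σ x i j = T.weight F σ x' i j := by
  simp only [weight, score, hi, hj]

theorem summand_congr {c : Fin dv} (hi : x i = x' i) (hj : x j = x' j) :
    T.summand F σ x i c j = T.summand F σ x' i c j := by
  simp only [summand, weight_congr hi hj, hj]

theorem prefixState_congr {k : ℕ} {hk : k ≤ N} (hi : x i = x' i)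
    (h : ∀ j : Fin N, (j : ℕ) < k → x j = x' j) :
    T.prefixState F σ x i hk = T.prefixState F σ x' i hk := by
  have hx (j : Fin k) : x (Fin.castLE hk j) = x' (Fin.castLE hk j) := h _ j.2
  simp only [prefixState, summand_congr hi (hx _), weight_congr hi (hx _)]

theorem output_congr_of_prefixState_eq {k : ℕ} {hk : k ≤ N} (hi : x i = x' i)
    (hprefix : T.prefixState F σ x i hk = T.prefixState F σ x' i hk)
    (hsuffix : ∀ j : Fin N, k ≤ (j : ℕ) → x j = x' j) :
    T.output F σ x i = T.output F σ x' i := by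
  obtain ⟨hnum, hden⟩ := Prod.ext_iff.1 hprefix
  have hnumerator (c : Fin dv) : T.numerator F σ x i c = T.numerator F σ x' i c :=
    lsum_eq_of_prefix_eq hk (congrFun hnum c) fun j hj => summand_congr hi (hsuffix j hj)
  have hdenominator : T.denominator F σ x i = T.denominator F σ x' i :=
    lsum_eq_of_prefix_eq hk hden fun j hj => weight_congr hi (hsuffix j hj)
  have hattention : T.attention F σ x i = T.attention F σ x' i :=
    funext fun c => by rw [attention, attention, hnumerator, hdenominator]
  rw [output, output, hattention]

end Transformer

section InputRepresentation

variable {m n t e : ℕ}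

theorem inputRep_congr_left (y z z' : Fin m → Bool) {i : Fin n} (hi : (i : ℕ) < m) :
    inputRep n t e y z i = inputRep n t e y z' i := by
  unfold inputRep
  iterate 5 refine ite_congr rfl (fun _ => rfl) fun _ => ?_
  omega

theorem inputRep_congr_right (ht : 2 * t ≤ m) (ht0 : 0 < t) (y y' z : Fin m → Bool) {i : Fin n}
    (hi : m ≤ (i : ℕ)) : inputRep n t e y z i = inputRep n t e y' z i := by
  simp (disch := omega) only [inputRep, if_neg]

variable (n t e) in
/-- The input of the Transformer: the input representation, followed by the placeholder. -/
def tokens (y z : Fin m → Bool) : Fin (n + 1) → Token e :=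
  Fin.snoc (inputRep n t e y z) (zeroToken e)

theorem tokens_last (y z : Fin m → Bool) : tokens n t e y z (Fin.last n) = zeroToken e :=
  Fin.snoc_last (α := fun _ => Token e) _ _

theorem tokens_of_lt (y z : Fin m → Bool) {j : Fin (n + 1)} (h : (j : ℕ) < n) :
    tokens n t e y z j = inputRep n t e y z ⟨j, h⟩ :=
  Fin.snoc_castSucc (α := fun _ => Token e) _ _ ⟨j, h⟩

theorem tokens_congr_left (hmn : m ≤ n) (y z z' : Fin m → Bool) {j : Fin (n + 1)}
    (hj : (j : ℕ) < m) : tokens n t e y z j = tokens n t e y z' j := by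
  rw [tokens_of_lt _ _ (by omega), tokens_of_lt _ _ (by omega)]
  exact inputRep_congr_left _ _ _ hj

theorem tokens_congr_right (ht : 2 * t ≤ m) (ht0 : 0 < t) (y y' z : Fin m → Bool)
    {j : Fin (n + 1)} (hj : m ≤ (j : ℕ)) : tokens n t e y z j = tokens n t e y' z j := by
  rcases Nat.lt_or_ge (j : ℕ) n with h | h
  · rw [tokens_of_lt _ _ h, tokens_of_lt _ _ h]
    exact inputRep_congr_right ht ht0 _ _ _ hj
  · obtain rfl : j = Fin.last n := Fin.ext (by rw [Fin.val_last]; omega)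
    rw [tokens_last, tokens_last]

end InputRepresentation

variable {m n t e d dq dv dff : ℕ}

/-- The Transformer computes equality of `m`-bit strings in the input representation with
parameters `(t, e)` on all inputs that satisfy the promise `R`. -/
def ComputesEQOn (R : (Fin m → Bool) → (Fin m → Bool) → Prop) (n t e : ℕ) (hd : 0 < d)
    (T : Transformer (n + 1) (Token e) d dq dv dff) (F : Format) (σ : ℝ → ℝ) : Prop :=
  ∀ y z, R y z →
    T.output F σ (tokens n t e y z) (Fin.last n) ⟨0, hd⟩ = if y = z then 1 else 0

theorem prefixState_ne_of_computesEQOn {R : (Fin m → Bool) → (Fin m → Bool) → Prop}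
    (ht : 2 * t ≤ m) (ht0 : 0 < t) (hmn : m ≤ n + 1) {hd : 0 < d}
    {T : Transformer (n + 1) (Token e) d dq dv dff} {F : Format} {σ : ℝ → ℝ}
    (hT : ComputesEQOn R n t e hd T F σ) {y z : Fin m → Bool} (hyz : y ≠ z)
    (hR : R y z) (hR' : R z z) :
    T.prefixState F σ (tokens n t e y z) (Fin.last n) hmn ≠
      T.prefixState F σ (tokens n t e z z) (Fin.last n) hmn := fun hstate => by
  have houtput : T.output F σ (tokens n t e y z) (Fin.last n) =
      T.output F σ (tokens n t e z z) (Fin.last n) :=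
    Transformer.output_congr_of_prefixState_eq (by rw [tokens_last, tokens_last]) hstate
      fun j hj => tokens_congr_right ht ht0 y z z hj
  have hzero := hT y z hR
  rw [houtput, hT z z hR', if_pos rfl, if_neg hyz] at hzero
  exact one_ne_zero hzero

/-- Strings that start with `0` and lead to the same partial sums after the first half of the input
cannot be told apart by the second half; if `(dv + 1) * F.bits < m`, then there are two of them. -/
theorem not_computesEQOn {R : (Fin m → Bool) → (Fin m → Bool) → Prop}
    (hR : ∀ y z : Fin m → Bool, binVal y ≤ binVal z → bit z 1 = false → R y z) (ht : 2 * t ≤ m)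
    (ht0 : 0 < t) (hmn : m ≤ n) {F : Format} (hF : (dv + 1) * F.bits < m) (σ : ℝ → ℝ) (hd : 0 < d)
    (T : Transformer (n + 1) (Token e) d dq dv dff) : ¬ ComputesEQOn R n t e hd T F σ := by
  intro hT
  obtain ⟨k, rfl⟩ : ∃ k, m = k + 1 := ⟨m - 1, by omega⟩
  let string (f : Fin k → Bool) : Fin (k + 1) → Bool := Fin.cons false f
  let state (f : Fin k → Bool) :=
    T.prefixState F σ (tokens n t e (string f) (string f)) (Fin.last n) (by omega : k + 1 ≤ n + 1)
  have hstring : ∀ f, bit (string f) 1 = false := fun f => by simp [bit, string]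
  let P := F.permissible_finite.toFinset
  have hmem {x : ℝ} : x ∈ P ↔ x ∈ F.permissible := F.permissible_finite.mem_toFinset
  have hcard : (Fintype.piFinset (fun _ : Fin dv => P) ×ˢ P).card <
      (Finset.univ : Finset (Fin k → Bool)).card := by
    have hP : P.card < 2 ^ F.bits := by
      simpa only [P, Set.ncard_eq_toFinset_card _ F.permissible_finite] using F.ncard_permissible_lt
    calc _ = P.card ^ (dv + 1) := by simp [pow_succ]
      _ < (2 ^ F.bits) ^ (dv + 1) := Nat.pow_lt_pow_left hP (Nat.succ_ne_zero dv)
      _ ≤ 2 ^ k := by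
        rw [← pow_mul, mul_comm]; exact Nat.pow_le_pow_right two_pos (by omega)
      _ = _ := by simp
  obtain ⟨f, -, f', -, hne, hstate⟩ := Finset.exists_ne_map_eq_of_card_lt_of_maps_to hcard
    (f := state) fun f _ => Finset.mem_coe.2 (Finset.mem_product.2
      ⟨Fintype.mem_piFinset.2 fun _ => hmem.2 (lsum_mem F _), hmem.2 (lsum_mem F _)⟩)
  wlog hle : binVal (string f) ≤ binVal (string f') generalizing f f'
  · exact this f' f hne.symm hstate.symm (le_of_not_ge hle)
  refine prefixState_ne_of_computesEQOn ht ht0 (by omega) hT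
    (fun h => hne (Fin.cons_right_injective _ h))
    (hR _ _ hle (hstring f')) (hR _ _ le_rfl (hstring f')) (.trans ?_ hstate)
  exact Transformer.prefixState_congr (by rw [tokens_last, tokens_last])
    fun j hj => tokens_congr_left hmn _ _ _ hj

end LowerBound

section Bits

/-- The number whose binary expression is `g 0, …, g (k - 1)`. -/
def bitsVal (g : ℕ → Bool) : ℕ → ℕ
  | 0 => 0
  | k + 1 => 2 * bitsVal g k + (g k).toNat

theorem bitsVal_lt (g : ℕ → Bool) (k : ℕ) : bitsVal g k < 2 ^ k := by
  induction k with
  | zero => exact one_pos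
  | succ k ih =>
    have := Bool.toNat_le (g k)
    rw [bitsVal, pow_succ]
    omega

theorem bitsVal_add (g : ℕ → Bool) (k l : ℕ) :
    bitsVal g (k + l) = 2 ^ l * bitsVal g k + bitsVal (fun i => g (k + i)) l := by
  induction l with
  | zero => rw [add_zero, pow_zero, one_mul, bitsVal, add_zero]
  | succ l ih => rw [← Nat.add_assoc, bitsVal, ih, bitsVal, pow_succ]; ring

theorem bitsVal_congr {g g' : ℕ → Bool} {k : ℕ} (h : ∀ i < k, g i = g' i) :
    bitsVal g k = bitsVal g' k := by
  induction k with
  | zero => rfl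
  | succ k ih =>
    rw [bitsVal, bitsVal, ih fun i hi => h i (hi.trans k.lt_succ_self), h k k.lt_succ_self]

theorem eq_of_bitsVal_eq {g g' : ℕ → Bool} {k : ℕ} (h : bitsVal g k = bitsVal g' k) {i : ℕ}
    (hi : i < k) : g i = g' i := by
  induction k with
  | zero => exact absurd hi i.not_lt_zero
  | succ k ih =>
    have hle := Bool.toNat_le (g k)
    have hle' := Bool.toNat_le (g' k)
    rw [bitsVal, bitsVal] at h
    rcases Nat.lt_succ_iff_lt_or_eq.1 hi with hlt | rfl
    · exact ih (by omega) hlt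
    · have hbit : (g i).toNat = (g' i).toNat := by omega
      rw [← Bool.ofNat_toNat (g i), hbit, Bool.ofNat_toNat]

theorem bitsVal_add_lt_iff {g g' : ℕ → Bool} {k l : ℕ} :
    bitsVal g (k + l) < bitsVal g' (k + l) ↔ bitsVal g k < bitsVal g' k ∨
      bitsVal g k = bitsVal g' k ∧
        bitsVal (fun i => g (k + i)) l < bitsVal (fun i => g' (k + i)) l := by
  have hlow := bitsVal_lt (fun i => g (k + i)) l
  have hlow' := bitsVal_lt (fun i => g' (k + i)) l
  rw [bitsVal_add, bitsVal_add]
  rcases lt_trichotomy (bitsVal g k) (bitsVal g' k) with h | h | h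
  · have := Nat.mul_le_mul_left (2 ^ l) (Nat.succ_le_of_lt h)
    rw [Nat.succ_eq_add_one, mul_add_one] at this
    omega
  · rw [h]
    omega
  · have := Nat.mul_le_mul_left (2 ^ l) (Nat.succ_le_of_lt h)
    rw [Nat.succ_eq_add_one, mul_add_one] at this
    omega

theorem bitsVal_le_of_le {g g' : ℕ → Bool} {k m : ℕ} (hkm : k ≤ m)
    (h : bitsVal g m ≤ bitsVal g' m) : bitsVal g k ≤ bitsVal g' k := by
  obtain ⟨l, rfl⟩ := Nat.exists_eq_add_of_le hkm
  exact le_of_not_gt fun hlt => h.not_gt (bitsVal_add_lt_iff.2 (Or.inl hlt))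

theorem bitsVal_eq_sum (g : ℕ → Bool) (k : ℕ) :
    bitsVal g k = ∑ i ∈ Finset.range k, if g i then 2 ^ (k - 1 - i) else 0 := by
  induction k with
  | zero => rfl
  | succ k ih =>
    rw [bitsVal, ih, Finset.sum_range_succ, Finset.mul_sum]
    congr 1
    · refine Finset.sum_congr rfl fun i hi => ?_
      have := Finset.mem_range.1 hi
      rw [mul_ite, ← pow_succ', mul_zero, show k - 1 - i + 1 = k + 1 - 1 - i by omega]
    · cases g k <;> simp

/-- The bits of a string as a sequence that starts at index `0`, followed by zeros. -/
def bitStream {m : ℕ} (y : Fin m → Bool) (i : ℕ) : Bool := bit y (i + 1)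

theorem bitStream_of_lt {m : ℕ} (y : Fin m → Bool) {i : ℕ} (hi : i < m) :
    bitStream y i = y ⟨i, hi⟩ :=
  dif_pos (c := 1 ≤ i + 1 ∧ i + 1 ≤ m) ⟨i.succ_pos, hi⟩

theorem bit_eq_bitStream {m : ℕ} (y : Fin m → Bool) {i k : ℕ} (h : i = k + 1) :
    bit y i = bitStream y k := h ▸ rfl

theorem binVal_eq_bitsVal {m : ℕ} (y : Fin m → Bool) : binVal y = bitsVal (bitStream y) m := by
  rw [bitsVal_eq_sum, binVal, Finset.sum_range]
  simp only [bitStream_of_lt, Fin.is_lt, Fin.eta]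

end Bits

section TruncFloat

/-- The number `2 ^ κ * 1.f`, where the fraction `f` is cut off after `i` bits. -/
noncomputable def truncFloat (κ : ℤ) (f : ℕ → Bool) (i : ℕ) : ℝ :=
  ((2 ^ i + bitsVal f i : ℕ) : ℝ) * (2 : ℝ) ^ (κ - i)

theorem truncFloat_zero (κ : ℤ) (f : ℕ → Bool) : truncFloat κ f 0 = (2 : ℝ) ^ κ := by
  simp [truncFloat, bitsVal]

theorem truncFloat_succ (κ : ℤ) (f : ℕ → Bool) (i : ℕ) :
    truncFloat κ f (i + 1) =
      truncFloat κ f i + if f i then (2 : ℝ) ^ (κ - (i + 1 : ℕ)) else 0 := by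
  have hscale : (2 : ℝ) ^ (κ - (i : ℤ)) = 2 * (2 : ℝ) ^ (κ - ((i + 1 : ℕ) : ℤ)) := by
    rw [← zpow_one_add₀ two_ne_zero]; congr 1; push_cast; ring
  rw [truncFloat, truncFloat, bitsVal, hscale]
  cases f i <;> simp <;> ring

theorem truncFloat_eq_shift (κ : ℤ) (f : ℕ → Bool) (i r : ℕ) :
    truncFloat κ f i = (((2 ^ i + bitsVal f i) * 2 ^ r : ℕ) : ℝ) * (2 : ℝ) ^ (κ - (i + r : ℕ)) := by
  have hscale : (2 : ℝ) ^ (κ - i) = 2 ^ r * (2 : ℝ) ^ (κ - (i + r : ℕ)) := by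
    rw [← zpow_natCast, ← zpow_add₀ two_ne_zero]; congr 1; push_cast; ring
  rw [truncFloat, hscale]
  push_cast
  ring

theorem zpow_mul_truncFloat (s κ : ℤ) (f : ℕ → Bool) (i : ℕ) :
    (2 : ℝ) ^ s * truncFloat κ f i = truncFloat (s + κ) f i := by
  rw [truncFloat, truncFloat, add_sub_assoc, zpow_add₀ two_ne_zero]
  ring

theorem zpow_le_truncFloat (κ : ℤ) (f : ℕ → Bool) (i : ℕ) : (2 : ℝ) ^ κ ≤ truncFloat κ f i := by
  induction i with
  | zero => exact (truncFloat_zero κ f).ge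
  | succ i ih =>
    rw [truncFloat_succ]
    exact ih.trans (le_add_of_nonneg_right (by positivity))

theorem truncFloat_pos (κ : ℤ) (f : ℕ → Bool) (i : ℕ) : 0 < truncFloat κ f i :=
  (zpow_pos two_pos κ).trans_le (zpow_le_truncFloat κ f i)

theorem truncFloat_add_zpow_le (κ : ℤ) (f : ℕ → Bool) (i : ℕ) :
    truncFloat κ f i + (2 : ℝ) ^ (κ - i) ≤ (2 : ℝ) ^ (κ + 1) := by
  have hsum : 2 ^ i + bitsVal f i + 1 ≤ 2 ^ (i + 1) := by
    have := bitsVal_lt f i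
    rw [pow_succ]; omega
  calc truncFloat κ f i + (2 : ℝ) ^ (κ - i)
      = ((2 ^ i + bitsVal f i + 1 : ℕ) : ℝ) * (2 : ℝ) ^ (κ - i) := by
        rw [truncFloat]; push_cast; ring
    _ ≤ ((2 ^ (i + 1) : ℕ) : ℝ) * (2 : ℝ) ^ (κ - i) := by gcongr
    _ = (2 : ℝ) ^ (κ + 1) := by
        push_cast
        rw [← zpow_natCast, ← zpow_add₀ two_ne_zero]
        congr 1
        push_cast
        ring

variable {κ κ' : ℤ} {f f' : ℕ → Bool} {i : ℕ}

theorem truncFloat_congr (hκ : κ = κ') (h : bitsVal f i = bitsVal f' i) :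
    truncFloat κ f i = truncFloat κ' f' i := by
  rw [truncFloat, truncFloat, hκ, h]

theorem truncFloat_add_ulp_le (h : κ < κ' ∨ κ = κ' ∧ bitsVal f i < bitsVal f' i) :
    truncFloat κ f i + (2 : ℝ) ^ (κ - i) ≤ truncFloat κ' f' i := by
  rcases h with h | ⟨rfl, h⟩
  · exact (truncFloat_add_zpow_le κ f i).trans
      ((zpow_le_zpow_right₀ one_le_two (by omega)).trans (zpow_le_truncFloat κ' f' i))
  · calc truncFloat κ f i + (2 : ℝ) ^ (κ - i)
        = ((2 ^ i + bitsVal f i + 1 : ℕ) : ℝ) * (2 : ℝ) ^ (κ - i) := by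
          rw [truncFloat]; push_cast; ring
      _ ≤ truncFloat κ f' i :=
          mul_le_mul_of_nonneg_right (Nat.cast_le.2 (by omega)) (zpow_nonneg zero_le_two _)

theorem truncFloat_lt_iff : truncFloat κ f i < truncFloat κ' f' i ↔
    κ < κ' ∨ κ = κ' ∧ bitsVal f i < bitsVal f' i := by
  have hulp (k : ℤ) : (0 : ℝ) < (2 : ℝ) ^ k := zpow_pos two_pos k
  refine ⟨fun h => ?_, fun h => by linarith [truncFloat_add_ulp_le h, hulp (κ - i)]⟩
  by_contra! hnot
  obtain ⟨hle, hbits⟩ := hnot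
  rcases hle.lt_or_eq with hlt | heq
  · linarith [truncFloat_add_ulp_le (f := f') (f' := f) (i := i) (Or.inl hlt), hulp (κ' - i)]
  · rcases (hbits heq.symm).lt_or_eq with hlt | heq'
    · linarith [truncFloat_add_ulp_le (Or.inr ⟨heq, hlt⟩), hulp (κ' - i)]
    · exact h.ne (truncFloat_congr heq.symm heq'.symm)

theorem exponent_eq_of_truncFloat_eq (h : truncFloat κ f i = truncFloat κ' f' i) : κ = κ' := by
  by_contra hne
  rcases lt_or_gt_of_ne hne with hlt | hlt
  exacts [(truncFloat_lt_iff.2 (Or.inl hlt)).ne h, (truncFloat_lt_iff.2 (Or.inl hlt)).ne' h]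

theorem truncFloat_mul_zpow_le (κ : ℤ) (f : ℕ → Bool) (i : ℕ) :
    truncFloat κ f i * (2 : ℝ) ^ (-(i + 1 : ℤ)) ≤ (2 : ℝ) ^ (κ - i) := by
  have hscale : (2 : ℝ) ^ (κ - i) = (2 : ℝ) ^ (κ + 1) * (2 : ℝ) ^ (-(i + 1 : ℤ)) := by
    rw [← zpow_add₀ two_ne_zero]; congr 1; ring
  have hulp : (0 : ℝ) < (2 : ℝ) ^ (κ - i) := zpow_pos two_pos _
  rw [hscale]
  gcongr
  linarith [truncFloat_add_zpow_le κ f i]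

theorem truncFloat_mul_one_add_le (h : truncFloat κ f i < truncFloat κ' f' i) :
    truncFloat κ f i * (1 + (2 : ℝ) ^ (-(i + 1 : ℤ))) ≤ truncFloat κ' f' i := by
  linarith [truncFloat_add_ulp_le (truncFloat_lt_iff.1 h), truncFloat_mul_zpow_le κ f i]

theorem truncFloat_le_mul_one_sub (h : truncFloat κ f i < truncFloat κ' f' i) :
    truncFloat κ f i ≤ truncFloat κ' f' i * (1 - (2 : ℝ) ^ (-(i + 1 : ℤ))) := by
  have hgap := truncFloat_add_ulp_le (truncFloat_lt_iff.1 h)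
  rcases truncFloat_lt_iff.1 h with hlt | ⟨rfl, -⟩
  · have hfactor : (0 : ℝ) ≤ 1 - (2 : ℝ) ^ (-(i + 1 : ℤ)) :=
      sub_nonneg.2 (zpow_le_one_of_nonpos₀ one_le_two (by omega))
    calc truncFloat κ f i ≤ (2 : ℝ) ^ (κ + 1) - (2 : ℝ) ^ (κ - i) := by
          linarith [truncFloat_add_zpow_le κ f i]
      _ = (2 : ℝ) ^ (κ + 1) * (1 - (2 : ℝ) ^ (-(i + 1 : ℤ))) := by
          rw [mul_sub, mul_one, ← zpow_add₀ two_ne_zero]; congr 2; ring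
      _ ≤ truncFloat κ' f' i * (1 - (2 : ℝ) ^ (-(i + 1 : ℤ))) := by
          gcongr
          exact (zpow_le_zpow_right₀ one_le_two (by omega)).trans (zpow_le_truncFloat κ' f' i)
  · linarith [truncFloat_mul_zpow_le κ f' i]

/-- The float whose binary expression is `g 0, …, g (k + l - 1)`: the first `k` bits are its
exponent, relative to `A`, and the other `l` bits are its fraction. -/
noncomputable def packedFloat (A : ℤ) (g : ℕ → Bool) (k l : ℕ) : ℝ :=
  truncFloat (A + bitsVal g k) (fun i => g (k + i)) l

theorem packedFloat_lt_iff {A : ℤ} {g g' : ℕ → Bool} {k l : ℕ} :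
    packedFloat A g k l < packedFloat A g' k l ↔ bitsVal g (k + l) < bitsVal g' (k + l) := by
  rw [packedFloat, packedFloat, truncFloat_lt_iff, bitsVal_add_lt_iff]
  omega

theorem packedFloat_le_iff {A : ℤ} {g g' : ℕ → Bool} {k l : ℕ} :
    packedFloat A g k l ≤ packedFloat A g' k l ↔ bitsVal g (k + l) ≤ bitsVal g' (k + l) := by
  rw [← not_lt, packedFloat_lt_iff, not_lt]

theorem packedFloat_inj {A : ℤ} {g g' : ℕ → Bool} {k l : ℕ} :
    packedFloat A g k l = packedFloat A g' k l ↔ bitsVal g (k + l) = bitsVal g' (k + l) := by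
  rw [le_antisymm_iff, packedFloat_le_iff, packedFloat_le_iff, ← le_antisymm_iff]

end TruncFloat

namespace Format

variable (F : Format)

theorem truncFloat_mem {κ : ℤ} (f : ℕ → Bool) {i : ℕ} (hi : i ≤ F.M) (hκ : -F.emax ≤ κ - i)
    (hκ' : κ ≤ F.emax) : truncFloat κ f i ∈ F.permissible :=
  F.natCast_mul_zpow_mem hi (by have := bitsVal_lt f i; rw [pow_succ]; omega) hκ (by omega)

theorem truncFloat_sub_truncFloat_mem {κ : ℤ} (f f' : ℕ → Bool) {i q : ℕ} (hi : i ≤ q)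
    (hq : q ≤ F.M) (hκ : -F.emax ≤ κ - q) (hκ' : κ ≤ F.emax) :
    truncFloat κ f i - truncFloat κ f' q ∈ F.permissible := by
  obtain ⟨r, rfl⟩ := Nat.exists_eq_add_of_le hi
  have hdiff : truncFloat κ f i - truncFloat κ f' (i + r) =
      (((2 ^ i + bitsVal f i) * 2 ^ r - (2 ^ (i + r) + bitsVal f' (i + r)) : ℤ) : ℝ) *
        (2 : ℝ) ^ (κ - (i + r : ℕ)) := by
    rw [truncFloat_eq_shift κ f i r, truncFloat]
    push_cast
    ring
  have hupper : (2 ^ i + bitsVal f i) * 2 ^ r < 2 ^ (i + r + 1) := by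
    rw [add_right_comm, pow_add _ (i + 1)]
    gcongr
    have := bitsVal_lt f i
    omega
  have hlower : bitsVal f' (i + r) < 2 ^ (i + r) := bitsVal_lt f' _
  have hpow : (2 : ℤ) ^ (i + r) ≤ (2 ^ i + bitsVal f i) * 2 ^ r := by
    rw [pow_add]
    gcongr
    exact le_add_of_nonneg_right (Int.natCast_nonneg _)
  rw [hdiff]
  refine F.intCast_mul_zpow_mem hq (abs_lt.2 ⟨?_, ?_⟩) hκ (by omega)
  · zify at hlower
    rw [pow_succ]
    linarith [pow_pos (two_pos : (0 : ℤ) < 2) (i + r)]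
  · zify at hupper
    linarith [pow_pos (two_pos : (0 : ℤ) < 2) (i + r), Int.natCast_nonneg (bitsVal f' (i + r))]

theorem round_truncFloat_add {κ : ℤ} (f : ℕ → Bool) {i : ℕ} {δ : ℝ} (hi : i ≤ F.M)
    (hκ : -F.emax ≤ κ) (hκ' : κ ≤ F.emax) (hδ : 0 ≤ δ) (hδ' : δ ≤ (2 : ℝ) ^ (κ - F.M - 1)) :
    F.round (truncFloat κ f i + δ) = truncFloat κ f i := by
  obtain ⟨r, hr⟩ := Nat.exists_eq_add_of_le hi
  rw [truncFloat_eq_shift κ f i r, ← hr]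
  refine F.round_add_of_le_half_ulp ?_ ?_ (by omega) (by omega) hδ hδ'
  · rw [hr, pow_add]
    exact Nat.mul_le_mul_right _ (Nat.le_add_right _ _)
  · rw [hr, add_right_comm, pow_add _ (i + 1)]
    gcongr
    have := bitsVal_lt f i
    omega

end Format

section Accumulation

/-- The value of an accumulator that starts at `s`, after the first `k` terms of `g` were added. -/
def accum (ρ : ℝ → ℝ) (g : ℕ → ℝ) (s : ℝ) : ℕ → ℝ
  | 0 => s
  | k + 1 => add ρ (accum ρ g s k) (g k)

theorem accum_add (ρ : ℝ → ℝ) (g : ℕ → ℝ) (s : ℝ) (k l : ℕ) :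
    accum ρ g s (k + l) = accum ρ (fun i => g (k + i)) (accum ρ g s k) l := by
  induction l with
  | zero => rfl
  | succ l ih => rw [← Nat.add_assoc, accum, ih, accum]

theorem accum_succ' (ρ : ℝ → ℝ) (g : ℕ → ℝ) (s : ℝ) (k : ℕ) :
    accum ρ g s (k + 1) = accum ρ (fun i => g (i + 1)) (add ρ s (g 0)) k := by
  rw [add_comm k 1, accum_add]
  simp only [accum, add_comm 1]

theorem accum_eq_of_step {ρ : ℝ → ℝ} {g : ℕ → ℝ} {k : ℕ} (P : ℕ → ℝ)
    (h : ∀ i < k, add ρ (P i) (g i) = P (i + 1)) : accum ρ g (P 0) k = P k := by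
  induction k with
  | zero => rfl
  | succ k ih =>
    rw [accum, ih fun i hi => h i (hi.trans k.lt_succ_self), h k k.lt_succ_self]

theorem accum_eq_self {ρ : ℝ → ℝ} {g : ℕ → ℝ} {s : ℝ} {k : ℕ} (h : ∀ i < k, add ρ s (g i) = s) :
    accum ρ g s k = s :=
  accum_eq_of_step (fun _ => s) h

theorem lsum_eq_accum (ρ : ℝ → ℝ) {k : ℕ} (x : Fin k → ℝ) {g : ℕ → ℝ}
    (h : ∀ i : Fin k, x i = g i) : lsum ρ x = accum ρ g 0 k := by
  induction k with
  | zero => rfl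
  | succ k ih =>
    have hlast : x (Fin.last k) = g k := h (Fin.last k)
    rw [accum, ← ih (fun i => x i.castSucc) fun i => h i.castSucc, ← hlast, lsum, lsum,
      List.ofFn_succ_last, List.foldl_append, List.foldl_cons, List.foldl_nil]

variable {F : Format} {g : ℕ → ℝ} {s : ℝ}

theorem accum_mem (hs : s ∈ F.permissible) (k : ℕ) : accum F.round g s k ∈ F.permissible := by
  cases k with
  | zero => exact hs
  | succ k => exact F.round_mem _

theorem accum_eq_self_of_eq_zero {k : ℕ} (hs : s ∈ F.permissible) (h : ∀ i < k, g i = 0) :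
    accum F.round g s k = s :=
  accum_eq_self fun i hi => by rw [h i hi, F.add_zero_eq hs]

theorem le_accum {U : ℝ} {k : ℕ} (hU : U ∈ F.permissible) (hs : s ∈ F.permissible) (h : U ≤ s)
    (hg : ∀ i < k, 0 ≤ g i) : U ≤ accum F.round g s k := by
  induction k with
  | zero => exact h
  | succ k ih =>
    rw [accum, add, F.round_eq_self (accum_mem hs k)]
    have hle := ih fun i hi => hg i (hi.trans k.lt_succ_self)
    exact F.le_round hU (le_add_of_le_of_nonneg hle (F.round_nonneg (hg k k.lt_succ_self)))

theorem accum_le_zpow_add {A : ℤ} {k : ℕ} (hA : -F.emax ≤ A) (hk : A + k ≤ F.emax)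
    (hg : ∀ i < k, g i = (2 : ℝ) ^ A) : accum F.round g 0 k ≤ (2 : ℝ) ^ (A + k) := by
  induction k with
  | zero => exact zpow_nonneg zero_le_two _
  | succ k ih =>
    push_cast at hk ⊢
    have hle := ih (by omega) fun i hi => hg i (hi.trans k.lt_succ_self)
    rw [accum, hg k k.lt_succ_self, F.add_eq_round (accum_mem F.zero_mem k)
      (F.zpow_mem hA (by omega))]
    refine F.round_le (F.zpow_mem (by omega) (by omega)) ?_
    calc accum F.round g 0 k + (2 : ℝ) ^ A ≤ (2 : ℝ) ^ (A + k) + (2 : ℝ) ^ (A + k) :=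
          add_le_add hle (zpow_le_zpow_right₀ one_le_two (by omega))
      _ = (2 : ℝ) ^ (A + (k + 1)) := by
          rw [← add_assoc, zpow_add_one₀ two_ne_zero, mul_two]

/-- The terms `g 0, …, g q` transmit the number `c * 2 ^ κ * 1.f` bit by bit: first the leading
part with `a` bits of fraction, and then the next `q` bits, where `δ` stands for the bit `0`. -/
structure FloatTerms (g : ℕ → ℝ) (c δ : ℝ) (κ : ℤ) (f : ℕ → Bool) (a q : ℕ) : Prop where
  head : g 0 = c * truncFloat κ f a
  frac : ∀ i < q, g (i + 1) = if f (a + i) then c * (2 : ℝ) ^ (κ - (a + i + 1 : ℕ)) else δ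

namespace FloatTerms

variable {c δ : ℝ} {κ : ℤ} {f : ℕ → Bool} {a q : ℕ}

theorem nonneg (h : FloatTerms g c δ κ f a q) (hc : 0 ≤ c) (hδ : 0 ≤ δ) {i : ℕ} (hi : i ≤ q) :
    0 ≤ g i := by
  rcases i with - | i
  · rw [h.head]
    exact mul_nonneg hc (truncFloat_pos κ f a).le
  · rw [h.frac i hi]
    split_ifs
    exacts [mul_nonneg hc (zpow_nonneg zero_le_two _), hδ]

theorem accum_frac (h : FloatTerms g c δ κ f a q) (hg : ∀ i, g i ∈ F.permissible)
    (hsum : ∀ i ≤ a + q, s + c * truncFloat κ f i ∈ F.permissible)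
    (hδ : ∀ i ≤ a + q, add F.round (s + c * truncFloat κ f i) δ = s + c * truncFloat κ f i) :
    accum F.round (fun i => g (i + 1)) (s + c * truncFloat κ f a) q =
      s + c * truncFloat κ f (a + q) := by
  refine accum_eq_of_step (fun i => s + c * truncFloat κ f (a + i)) fun i hi => ?_
  have hterm := h.frac i hi
  have hnext : s + c * truncFloat κ f (a + i + 1) = s + c * truncFloat κ f (a + i) +
      if f (a + i) then c * (2 : ℝ) ^ (κ - (a + i + 1 : ℕ)) else 0 := by
    rw [truncFloat_succ, mul_add, mul_ite, mul_zero, ← add_assoc]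
  by_cases hbit : f (a + i)
  · simp only [hbit, if_true] at hterm hnext
    rw [← add_assoc, hnext, ← hterm]
    refine F.add_eq_of_mem (hsum _ (by omega)) (hg _) ?_
    rw [hterm, ← hnext]
    exact hsum _ (by omega)
  · simp only [hbit, if_false, Bool.false_eq_true, add_zero] at hterm hnext
    rw [← add_assoc, hnext, hterm, hδ _ (by omega)]

theorem accum_eq (h : FloatTerms g c 0 κ f a q) (hg : ∀ i, g i ∈ F.permissible)
    (hs : s ∈ F.permissible) (hsum : ∀ i ≤ a + q, s + c * truncFloat κ f i ∈ F.permissible) :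
    accum F.round g s (q + 1) = s + c * truncFloat κ f (a + q) := by
  have hhead := hsum a (Nat.le_add_right a q)
  rw [← h.head] at hhead
  rw [accum_succ', F.add_eq_of_mem hs (hg 0) hhead, h.head]
  exact h.accum_frac hg hsum fun i hi => F.add_zero_eq (hsum i hi)

end FloatTerms

/-- The exponents are so far apart that the terms `2 ^ A` are lost when they are added to the
number, and also when `k` of them are accumulated before. -/
theorem accum_eq_truncFloat_of_noise {A κ : ℤ} {f : ℕ → Bool} {k a q l : ℕ} (haq : a + q ≤ F.M)
    (hA : -F.emax ≤ A) (hAκ : A + k ≤ κ - F.M - 1) (hκ : -F.emax ≤ κ - (a + q : ℕ))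
    (hκ' : κ ≤ F.emax) (hg : ∀ i, g i ∈ F.permissible) (hbefore : ∀ i < k, g i = (2 : ℝ) ^ A)
    (hterms : FloatTerms (fun i => g (k + i)) 1 ((2 : ℝ) ^ A) κ f a q)
    (hafter : ∀ i < l, g (k + (q + 1) + i) = (2 : ℝ) ^ A) :
    accum F.round g 0 (k + (q + 1) + l) = truncFloat κ f (a + q) := by
  have hmem {i : ℕ} (hi : i ≤ a + q) : truncFloat κ f i ∈ F.permissible :=
    F.truncFloat_mem f (hi.trans haq) (by omega) hκ'
  have habsorb {i : ℕ} (hi : i ≤ a + q) :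
      add F.round (truncFloat κ f i) ((2 : ℝ) ^ A) = truncFloat κ f i := by
    rw [F.add_eq_round (hmem hi) (F.zpow_mem hA (by omega))]
    exact F.round_truncFloat_add f (hi.trans haq) (by omega) hκ' (zpow_nonneg zero_le_two _)
      (zpow_le_zpow_right₀ one_le_two (by omega))
  have hhead : add F.round (accum F.round g 0 k) (g (k + 0)) = truncFloat κ f a := by
    have hle := accum_le_zpow_add hA (by omega) hbefore
    have hnonneg : 0 ≤ accum F.round g 0 k := le_accum F.zero_mem F.zero_mem le_rfl fun i hi => by
      rw [hbefore i hi]; exact zpow_nonneg zero_le_two _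
    rw [hterms.head, one_mul, F.add_eq_round (accum_mem F.zero_mem k) (hmem (by omega)), add_comm]
    exact F.round_truncFloat_add f (by omega) (by omega) hκ' hnonneg
      (hle.trans (zpow_le_zpow_right₀ one_le_two (by omega)))
  have hfrac := hterms.accum_frac (F := F) (s := 0) (fun i => hg _)
    (by simpa only [zero_add, one_mul] using fun i hi => hmem hi)
    (by simpa only [zero_add, one_mul] using fun i hi => habsorb hi)
  rw [zero_add, one_mul, zero_add, one_mul] at hfrac
  rw [accum_add, accum_add, accum_succ', hhead, hfrac]
  exact accum_eq_self fun i hi => by rw [hafter i hi, habsorb le_rfl]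

/-- The terms of the numerator: they subtract the number `2 ^ κ * 1.f`, add `2 ^ κ' * 1.f'` after
`m` terms, and then add `2 ^ μ * 1.h`. -/
structure NumeratorTerms (F : Format) (G : ℕ → ℝ) (κ κ' μ : ℤ) (f f' h : ℕ → Bool)
    (q r m N : ℕ) : Prop where
  mem : ∀ j, G j ∈ F.permissible
  first : FloatTerms G (-1) 0 κ f 0 q
  gap : ∀ j, q + 1 ≤ j → j < m → G j = 0
  second : FloatTerms (fun i => G (m + i)) 1 0 κ' f' 0 q
  low : FloatTerms (fun i => G (m + (q + 1) + i)) 1 0 μ h 1 r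
  tail : ∀ j, m + (q + 1) + (r + 1) ≤ j → j < N → G j = 0

namespace NumeratorTerms

variable {G : ℕ → ℝ} {κ κ' μ : ℤ} {f f' h : ℕ → Bool} {q r m N : ℕ}

theorem nonneg (hG : NumeratorTerms F G κ κ' μ f f' h q r m N) {j : ℕ} (hj : m ≤ j)
    (hjN : j < N) : 0 ≤ G j := by
  obtain ⟨i, rfl⟩ := Nat.exists_eq_add_of_le hj
  rcases Nat.lt_or_ge q i with hi | hi
  · obtain ⟨i, rfl⟩ := Nat.exists_eq_add_of_le (Nat.succ_le_of_lt hi)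
    rw [← Nat.add_assoc] at hjN ⊢
    rcases Nat.lt_or_ge r i with hi' | hi'
    · exact (hG.tail _ (by omega) hjN).ge
    · exact hG.low.nonneg zero_le_one le_rfl hi'
  · exact hG.second.nonneg zero_le_one le_rfl hi

theorem accum_first (hG : NumeratorTerms F G κ κ' μ f f' h q r m N) (hq : q ≤ F.M)
    (hκ : -F.emax ≤ κ - q) (hκ' : κ ≤ F.emax) (hm : q + 1 ≤ m) :
    accum F.round G 0 m = -truncFloat κ f q := by
  obtain ⟨l, rfl⟩ := Nat.exists_eq_add_of_le hm
  have hmem (i : ℕ) (hi : i ≤ 0 + q) : 0 + -1 * truncFloat κ f i ∈ F.permissible := by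
    rw [zero_add, neg_one_mul]
    exact F.neg_mem (F.truncFloat_mem f (by omega) (by omega) hκ')
  rw [accum_add, hG.first.accum_eq hG.mem F.zero_mem hmem,
    accum_eq_self_of_eq_zero (hmem _ le_rfl) fun i _ => hG.gap _ (by omega) (by omega)]
  rw [zero_add, zero_add, neg_one_mul]

theorem accum_second (hG : NumeratorTerms F G κ κ μ f f' h q r m N) (hq : q ≤ F.M)
    (hκ : -F.emax ≤ κ - q) (hκ' : κ ≤ F.emax) (hm : q + 1 ≤ m) :
    accum F.round G 0 (m + (q + 1)) = truncFloat κ f' q - truncFloat κ f q := by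
  rw [accum_add, hG.accum_first hq hκ hκ' hm, hG.second.accum_eq (fun _ => hG.mem _)
    (F.neg_mem (F.truncFloat_mem f hq hκ hκ')), zero_add, one_mul, neg_add_eq_sub]
  intro i hi
  rw [one_mul, neg_add_eq_sub]
  exact F.truncFloat_sub_truncFloat_mem f' f (by omega) hq hκ hκ'

theorem accum_eq (hG : NumeratorTerms F G κ κ' μ f f' h q r m N) (hq : q ≤ F.M)
    (hκ : -F.emax ≤ κ - q) (hκ' : κ ≤ F.emax) (hm : q + 1 ≤ m) (hr : 1 + r ≤ F.M)
    (hμ : -F.emax ≤ μ - (1 + r : ℕ)) (hμ' : μ ≤ F.emax) (hN : m + (q + 1) + (r + 1) ≤ N)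
    (hff : truncFloat κ f q = truncFloat κ' f' q) :
    accum F.round G 0 N = truncFloat μ h (1 + r) := by
  obtain rfl := exponent_eq_of_truncFloat_eq hff
  obtain ⟨l, rfl⟩ := Nat.exists_eq_add_of_le hN
  have hmem (i : ℕ) (hi : i ≤ 1 + r) : 0 + 1 * truncFloat μ h i ∈ F.permissible := by
    rw [zero_add, one_mul]
    exact F.truncFloat_mem h (hi.trans hr) (by omega) hμ'
  rw [accum_add, accum_add _ _ _ (m + (q + 1)), hG.accum_second hq hκ hκ' hm, hff, sub_self,
    hG.low.accum_eq (fun _ => hG.mem _) F.zero_mem hmem,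
    accum_eq_self_of_eq_zero (hmem _ le_rfl) fun i _ => hG.tail _ (by omega) (by omega)]
  rw [zero_add, one_mul]

theorem zpow_le_accum (hG : NumeratorTerms F G κ κ' μ f f' h q r m N) (hq : q ≤ F.M)
    (hκ : -F.emax ≤ κ - q) (hκ' : κ ≤ F.emax) (hκ'' : κ' ≤ F.emax) (hm : q + 1 ≤ m)
    (hN : m + (q + 1) ≤ N) (hlt : truncFloat κ f q < truncFloat κ' f' q) :
    (2 : ℝ) ^ (κ - q) ≤ accum F.round G 0 N := by
  have hU : (2 : ℝ) ^ (κ - q) ∈ F.permissible := F.zpow_mem hκ (by omega)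
  have hmem : truncFloat κ f q ∈ F.permissible := F.truncFloat_mem f hq hκ hκ'
  suffices ∃ j, m ≤ j ∧ j ≤ N ∧ (2 : ℝ) ^ (κ - q) ≤ accum F.round G 0 j by
    obtain ⟨j, hmj, hjN, hle⟩ := this
    obtain ⟨l, rfl⟩ := Nat.exists_eq_add_of_le hjN
    rw [accum_add]
    exact le_accum hU (accum_mem F.zero_mem _) hle fun i _ => hG.nonneg (by omega) (by omega)
  rcases truncFloat_lt_iff.1 hlt with hexp | ⟨rfl, -⟩
  · refine ⟨m + 1, by omega, by omega, ?_⟩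
    have hhead : G m = (2 : ℝ) ^ κ' := by
      simpa only [add_zero, one_mul, truncFloat_zero] using hG.second.head
    rw [accum, hG.accum_first hq hκ hκ' hm, hhead,
      F.add_eq_round (F.neg_mem hmem) (F.zpow_mem (by omega) hκ'')]
    refine F.le_round hU ?_
    linarith [truncFloat_add_zpow_le κ f q,
      zpow_le_zpow_right₀ (one_le_two : (1 : ℝ) ≤ 2) (by omega : κ + 1 ≤ κ')]
  · refine ⟨m + (q + 1), by omega, hN, ?_⟩
    rw [hG.accum_second hq hκ hκ' hm]
    linarith [truncFloat_add_ulp_le (truncFloat_lt_iff.1 hlt)]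

end NumeratorTerms

end Accumulation

namespace Format

variable (F : Format)

theorem zpow_mul_one_add_mem {γ : ℤ} (hM : 0 < F.M) (hγ : -F.emax ≤ γ) (hγ' : γ ≤ F.emax) :
    (2 : ℝ) ^ γ * (1 + (2 : ℝ) ^ (-(F.M : ℤ))) ∈ F.permissible := by
  have hpow : 1 < 2 ^ F.M := Nat.one_lt_two_pow hM.ne'
  convert F.normalized_mem (n := 2 ^ F.M + 1) (k := γ - F.M) (by omega) (by rw [pow_succ]; omega)
    (by omega) (by omega) using 1
  push_cast
  rw [zpow_sub₀ two_ne_zero, zpow_neg, zpow_natCast]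
  field_simp

theorem zpow_mul_one_sub_mem {γ : ℤ} (hM : 0 < F.M) (hγ : -F.emax ≤ γ - 1) (hγ' : γ ≤ F.emax) :
    (2 : ℝ) ^ γ * (1 - (2 : ℝ) ^ (-(F.M : ℤ))) ∈ F.permissible := by
  have hpow : 1 < 2 ^ F.M := Nat.one_lt_two_pow hM.ne'
  convert F.normalized_mem (n := (2 ^ F.M - 1) * 2) (k := γ - 1 - F.M) (by omega)
    (by rw [pow_succ]; omega) (by omega) (by omega) using 1
  push_cast [Nat.cast_sub hpow.le]
  rw [zpow_sub₀ two_ne_zero, zpow_sub₀ two_ne_zero, zpow_neg, zpow_natCast, zpow_one]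
  field_simp

end Format

section SmallSums

variable (ρ : ℝ → ℝ)

theorem lsum_one (x : Fin 1 → ℝ) : lsum ρ x = add ρ 0 (x 0) := rfl

theorem lsum_two (x : Fin 2 → ℝ) : lsum ρ x = add ρ (add ρ 0 (x 0)) (x 1) := rfl

theorem lsum_three (x : Fin 3 → ℝ) :
    lsum ρ x = add ρ (add ρ (add ρ 0 (x 0)) (x 1)) (x 2) := rfl

end SmallSums

section TestTransformer

/-- The Transformer with attention weights `w` and values `v`, whose MLP tests, in a format with
`M` bits of mantissa, whether its input `R` is `2 ^ γ`: with the hidden nodes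
`relu (±(R / 2 ^ γ - 1))`, its output is `relu (1 - 2 ^ M * |R / 2 ^ γ - 1|)`. -/
noncomputable def testTransformer {A : Type} (n : ℕ) (w v : ℕ → A → ℝ) (γ : ℤ) (M : ℕ) :
    Transformer (n + 1) A 3 1 1 2 where
  embed j x := ![1, Real.log (w j x), v j x]
  WQ a _ := ![1, 0, 0] a
  WK a _ := ![0, 1, 0] a
  WV a _ := ![0, 0, 1] a
  w1 _ j := ![(2 : ℝ) ^ (-γ), -(2 : ℝ) ^ (-γ)] j
  b1 j := ![-1, 1] j
  w2 _ _ := -(2 : ℝ) ^ M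
  b2 _ := 1

/-- The contribution of the hidden node with weight `ω` and bias `b` to the output nodes of
`testTransformer`, on the input `R`. -/
noncomputable def nodeContribution (F : Format) (ω b R : ℝ) : ℝ :=
  F.round (max 0 (F.round (F.round (R * ω) + b)) * -(2 : ℝ) ^ F.M)

variable {F : Format}

theorem nodeContribution_mem (F : Format) (ω b R : ℝ) :
    nodeContribution F ω b R ∈ F.permissible := F.round_mem _

theorem nodeContribution_nonpos (F : Format) (ω b R : ℝ) : nodeContribution F ω b R ≤ 0 :=
  F.round_nonpos (mul_nonpos_of_nonneg_of_nonpos (le_max_left _ _)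
    (neg_nonpos.2 (pow_nonneg zero_le_two _)))

theorem nodeContribution_le_neg_one {ω b R : ℝ} (hM : F.M ≤ F.emax)
    (h : (2 : ℝ) ^ (-(F.M : ℤ)) ≤ F.round (R * ω) + b) : nodeContribution F ω b R ≤ -1 := by
  have hactive : (2 : ℝ) ^ (-(F.M : ℤ)) ≤ max 0 (F.round (F.round (R * ω) + b)) :=
    le_max_of_le_right (F.le_round (F.zpow_mem (by omega) (by omega)) h)
  refine F.round_le (F.neg_mem F.one_mem) ?_
  rw [mul_neg, neg_le_neg_iff]
  calc (1 : ℝ) = (2 : ℝ) ^ (-(F.M : ℤ)) * 2 ^ F.M := by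
        rw [zpow_neg, zpow_natCast, inv_mul_cancel₀ (pow_ne_zero _ two_ne_zero)]
    _ ≤ _ := mul_le_mul_of_nonneg_right hactive (pow_nonneg zero_le_two _)

variable {A : Type} {n : ℕ} {w v : ℕ → A → ℝ} {γ : ℤ}

theorem testTransformer_weight (hw : ∀ j x, 0 < w j x) (hw' : ∀ j x, w j x ∈ F.permissible)
    (x : Fin (n + 1) → A) (i j : Fin (n + 1)) :
    (testTransformer n w v γ F.M).weight F id x i j = w j (x j) := by
  have hscore : (testTransformer n w v γ F.M).score id x i j = Real.log (w j (x j)) := by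
    simp [Transformer.score, testTransformer, dot, lsum_one, lsum_three, mul, add]
  rw [Transformer.weight, hscore, Real.exp_log (hw _ _), F.round_eq_self (hw' _ _)]

theorem testTransformer_summand (hw : ∀ j x, 0 < w j x) (hw' : ∀ j x, w j x ∈ F.permissible)
    (hv : ∀ j x, v j x ∈ F.permissible) (hwv : ∀ j x, w j x * v j x ∈ F.permissible)
    (x : Fin (n + 1) → A) (i j : Fin (n + 1)) :
    (testTransformer n w v γ F.M).summand F id x i 0 j = w j (x j) * v j (x j) := by
  rw [Transformer.summand, testTransformer_weight hw hw']
  simp [testTransformer, dot, lsum_three, mul, add, F.round_eq_self F.one_mem,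
    F.round_eq_self (hw' _ _), F.round_eq_self (hv _ _), F.round_eq_self (hwv _ _)]

theorem testTransformer_output (hw : ∀ j x, 0 < w j x) (hw' : ∀ j x, w j x ∈ F.permissible)
    (hv : ∀ j x, v j x ∈ F.permissible) (hwv : ∀ j x, w j x * v j x ∈ F.permissible)
    {x : Fin (n + 1) → A} {a : ℕ → A} (hx : ∀ j : Fin (n + 1), x j = a j) (i : Fin (n + 1)) :
    (testTransformer n w v γ F.M).output F id x i =
      (testTransformer n w v γ F.M).mlp F fun _ =>
        F.round (accum F.round (fun j => w j (a j) * v j (a j)) 0 (n + 1) /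
          accum F.round (fun j => w j (a j)) 0 (n + 1)) := by
  rw [Transformer.output]
  congr 1
  funext c
  rw [Subsingleton.elim c 0, Transformer.attention]
  congr 2
  · exact lsum_eq_accum F.round _ fun j => by
      rw [← hx j]; exact testTransformer_summand hw hw' hv hwv x i j
  · exact lsum_eq_accum F.round _ fun j => by rw [← hx j, testTransformer_weight hw hw']

theorem testTransformer_mlp (hγ : -F.emax ≤ γ) (hγ' : γ ≤ F.emax) (hM : F.M ≤ F.emax) {R : ℝ}
    (hR : R ∈ F.permissible) (k : Fin 3) :
    (testTransformer n w v γ F.M).mlp F (fun _ => R) k =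
      max 0 (F.round (F.round (nodeContribution F ((2 : ℝ) ^ (-γ)) (-1) R +
        nodeContribution F (-(2 : ℝ) ^ (-γ)) 1 R) + 1)) := by
  have hω : (2 : ℝ) ^ (-γ) ∈ F.permissible := F.zpow_mem (by omega) (by omega)
  have hw2 : -(2 : ℝ) ^ F.M ∈ F.permissible := by
    rw [← zpow_natCast]
    exact F.neg_mem (F.zpow_mem (by omega) hM)
  have hnode {ω b : ℝ} (hω : ω ∈ F.permissible) (hb : b ∈ F.permissible) :
      mul F.round (max 0 (add F.round (dot F.round (fun _ : Fin 1 => R) fun _ => ω) b))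
        (-(2 : ℝ) ^ F.M) = nodeContribution F ω b R := by
    rw [dot, lsum_one, F.mul_eq_round hR hω, F.zero_add_eq (F.round_mem _),
      F.add_eq_round (F.round_mem _) hb, F.mul_eq_round (F.max_zero_round_mem _) hw2,
      nodeContribution]
  change max 0 (add F.round (lsum F.round fun j : Fin 2 => mul F.round (max 0 (add F.round
    (dot F.round (fun _ : Fin 1 => R) fun _ => ![(2 : ℝ) ^ (-γ), -(2 : ℝ) ^ (-γ)] j)
    (![-1, 1] j))) (-(2 : ℝ) ^ F.M)) 1) = _
  simp only [lsum_two, Matrix.cons_val_zero, Matrix.cons_val_one]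
  rw [hnode hω (F.neg_mem F.one_mem), hnode (F.neg_mem hω) F.one_mem,
    F.zero_add_eq (nodeContribution_mem ..),
    F.add_eq_round (nodeContribution_mem ..) (nodeContribution_mem ..),
    F.add_eq_round (F.round_mem _) F.one_mem]

theorem testTransformer_mlp_eq_one (hγ : -F.emax ≤ γ) (hγ' : γ ≤ F.emax) (hM : F.M ≤ F.emax)
    (k : Fin 3) : (testTransformer n w v γ F.M).mlp F (fun _ => (2 : ℝ) ^ γ) k = 1 := by
  have hscale : (2 : ℝ) ^ γ * (2 : ℝ) ^ (-γ) = 1 := by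
    rw [← zpow_add₀ two_ne_zero, add_neg_cancel, zpow_zero]
  rw [testTransformer_mlp hγ hγ' hM (F.zpow_mem hγ hγ')]
  simp only [nodeContribution, mul_neg ((2 : ℝ) ^ γ), hscale, F.round_eq_self F.one_mem,
    F.round_eq_self (F.neg_mem F.one_mem), add_neg_cancel, neg_add_cancel, F.round_zero, max_self,
    zero_mul, add_zero, zero_add]
  exact max_eq_right zero_le_one

theorem testTransformer_mlp_eq_zero (hγ : -F.emax ≤ γ) (hγ' : γ ≤ F.emax) (hM : F.M ≤ F.emax)
    (hM0 : 0 < F.M) {R : ℝ} (hR : R ∈ F.permissible)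
    (h : (2 : ℝ) ^ γ * (1 + (2 : ℝ) ^ (-(F.M : ℤ))) ≤ R ∨
      R ≤ (2 : ℝ) ^ γ * (1 - (2 : ℝ) ^ (-(F.M : ℤ)))) (k : Fin 3) :
    (testTransformer n w v γ F.M).mlp F (fun _ => R) k = 0 := by
  rw [testTransformer_mlp hγ hγ' hM hR]
  suffices nodeContribution F ((2 : ℝ) ^ (-γ)) (-1) R +
      nodeContribution F (-(2 : ℝ) ^ (-γ)) 1 R ≤ -1 from
    max_eq_left (F.round_nonpos (by linarith [F.round_le (F.neg_mem F.one_mem) this]))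
  have hpos : (0 : ℝ) < (2 : ℝ) ^ γ := zpow_pos two_pos γ
  rcases h with h | h
  · have hmem := F.zpow_mul_one_add_mem (γ := 0) hM0 (by omega) (by omega)
    have hle : 1 + (2 : ℝ) ^ (-(F.M : ℤ)) ≤ R * (2 : ℝ) ^ (-γ) := by
      rwa [zpow_neg _ γ, ← div_eq_mul_inv, le_div_iff₀' hpos]
    rw [zpow_zero, one_mul] at hmem
    linarith [nodeContribution_nonpos F (-(2 : ℝ) ^ (-γ)) 1 R,
      nodeContribution_le_neg_one (b := -1) hM (by linarith [F.le_round hmem hle])]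
  · have hmem := F.neg_mem (F.zpow_mul_one_sub_mem (γ := 0) hM0 (by omega) (by omega))
    have hle : -(1 - (2 : ℝ) ^ (-(F.M : ℤ))) ≤ R * -(2 : ℝ) ^ (-γ) := by
      rwa [mul_neg, neg_le_neg_iff, zpow_neg _ γ, ← div_eq_mul_inv, div_le_iff₀' hpos]
    rw [zpow_zero, one_mul] at hmem
    linarith [nodeContribution_nonpos F ((2 : ℝ) ^ (-γ)) (-1) R,
      nodeContribution_le_neg_one (b := 1) hM (by linarith [F.le_round hmem hle])]

end TestTransformer

section Blocks

/-- The number at the token `i` of a block that transmits `c * 2 ^ κ * 1.f` in the sense of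
`FloatTerms`, where `b` is the last bit of the token. -/
noncomputable def floatTerm (c δ : ℝ) (κ : ℤ) (a i : ℕ) (b : Bool) : ℝ :=
  if i = 0 then c * truncFloat κ (fun _ => b) a
  else if b then c * (2 : ℝ) ^ (κ - (a + i : ℕ)) else δ

theorem FloatTerms.of_eq_floatTerm {g : ℕ → ℝ} {c δ : ℝ} {κ : ℤ} {f b : ℕ → Bool} {a q : ℕ}
    (ha : a ≤ 1) (hg : ∀ i ≤ q, g i = floatTerm c δ κ a i (b i))
    (hb : ∀ i ≤ q, ∀ k, a + i = k + 1 → b i = f k) : FloatTerms g c δ κ f a q where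
  head := by
    rw [hg 0 q.zero_le, floatTerm, if_pos rfl]
    congr 1
    exact truncFloat_congr rfl (bitsVal_congr fun k hk => hb 0 q.zero_le k (by omega))
  frac i hi := by
    rw [hg (i + 1) hi, floatTerm, if_neg i.succ_ne_zero, hb (i + 1) hi (a + i) rfl,
      Nat.add_assoc]

theorem floatTerm_pos {c δ : ℝ} (hc : 0 < c) (hδ : 0 < δ) (κ : ℤ) (a i : ℕ) (b : Bool) :
    0 < floatTerm c δ κ a i b := by
  unfold floatTerm
  split_ifs
  exacts [mul_pos hc (truncFloat_pos _ _ _), mul_pos hc (zpow_pos two_pos _), hδ]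

theorem floatTerm_mem {F : Format} {c δ : ℝ} {κ : ℤ} {a i : ℕ}
    (hc : ∀ x ∈ F.permissible, c * x ∈ F.permissible) (hδ : δ ∈ F.permissible) (ha : a ≤ F.M)
    (hκ : -F.emax ≤ κ - (a + i : ℕ)) (hκ' : κ ≤ F.emax) (b : Bool) :
    floatTerm c δ κ a i b ∈ F.permissible := by
  unfold floatTerm
  split_ifs
  exacts [hc _ (F.truncFloat_mem _ ha (by omega) hκ'), hc _ (F.zpow_mem hκ (by omega)), hδ]

theorem zpow_mul_floatTerm (s : ℤ) (c : ℝ) (κ : ℤ) (a i : ℕ) (b : Bool) :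
    (2 : ℝ) ^ s * floatTerm c 0 κ a i b = floatTerm c 0 (s + κ) a i b := by
  simp only [floatTerm, mul_ite, mul_left_comm _ c, zpow_mul_truncFloat, add_sub_assoc,
    zpow_add₀ (two_ne_zero' ℝ), mul_zero]

/-- The number whose binary expression is given by the first `l` bits of the tuple `u`. -/
def code {k : ℕ} (u : Fin k → Bool) (l : ℕ) : ℕ :=
  bitsVal (fun i => if h : i < k then u ⟨i, h⟩ else false) l

theorem code_lt {k : ℕ} (u : Fin k → Bool) (l : ℕ) : code u l < 2 ^ l := bitsVal_lt _ _

theorem code_tuple₁ {m : ℕ} (e : ℕ) (y : Fin m → Bool) :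
    code (tuple₁ e y) (e - 1) = bitsVal (bitStream y) (e - 1) :=
  bitsVal_congr fun _ hi => dif_pos hi

/-- The bits of a string that the second of its two blocks transmits. -/
def lowerBits {m : ℕ} (t e : ℕ) (y : Fin m → Bool) (i : ℕ) : Bool :=
  bitStream y (e - 1 + (t - 1) + i)

theorem code_tuple₂ {m t e : ℕ} (ht : 0 < t) (he : 0 < e) (hL : 0 < lg m) (y : Fin m → Bool) :
    code (tuple₂ t e y) (e - lg m) = bitsVal (lowerBits t e y) (e - lg m) :=
  bitsVal_congr fun i hi => by
    rw [dif_pos (by omega), tuple₂, if_pos hi]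
    exact bit_eq_bitStream y (by simp only []; omega)

variable {m t L e : ℕ}

variable (t L) in
/-- The attention weight at the token `x` with index `j`. The second block of `y`, with indices
`t, …, 2 * t - 3`, transmits a number with exponent `β + code`; all other weights are `2 ^ A`. -/
noncomputable def eqWeight (A β : ℤ) (j : ℕ) (x : Token e) : ℝ :=
  if t ≤ j ∧ j ≤ t + (t - 3) then
    floatTerm 1 ((2 : ℝ) ^ A) (β + code x.1 (e - L)) 1 (j - t) x.2
  else (2 : ℝ) ^ A

variable (m t L) in
/-- The value at the token `x` with index `j`. The first blocks of `y` and `z` transmit numbers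
with exponents `α + code`, the one of `y` with a negative sign; the second block of `z` transmits a
number with exponent `μ + code`. -/
noncomputable def eqValue (α μ : ℤ) (j : ℕ) (x : Token e) : ℝ :=
  if j < t then floatTerm (-1) 0 (α + code x.1 (e - 1)) 0 j x.2
  else if j < m then 0
  else if j < m + t then floatTerm 1 0 (α + code x.1 (e - 1)) 0 (j - m) x.2
  else if j ≤ m + t + (t - 3) then floatTerm 1 0 (μ + code x.1 (e - L)) 1 (j - (m + t)) x.2
  else 0

theorem eqWeight_pos (A β : ℤ) (j : ℕ) (x : Token e) : 0 < eqWeight t L A β j x := by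
  unfold eqWeight
  split_ifs
  exacts [floatTerm_pos one_pos (zpow_pos two_pos _) _ _ _ _, zpow_pos two_pos _]

theorem eqWeight_mul_eqValue (ht : t + (t - 3) < m) (A α β μ : ℤ) (j : ℕ) (x : Token e) :
    eqWeight t L A β j x * eqValue m t L α μ j x = eqValue m t L (A + α) (A + μ) j x := by
  by_cases hj : t ≤ j ∧ j ≤ t + (t - 3)
  · rw [eqValue, eqValue, if_neg (by omega), if_pos (by omega), if_neg (by omega),
      if_pos (by omega), mul_zero]
  · rw [eqWeight, if_neg hj]
    simp only [eqValue, mul_ite, mul_zero, zpow_mul_floatTerm, add_assoc]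

variable {F : Format} {A α β μ : ℤ}

theorem eqWeight_mem (hM : 0 < F.M) (hA : -F.emax ≤ A) (hA' : A ≤ F.emax)
    (hβ : -F.emax ≤ β - (1 + (t - 3) : ℕ)) (hβ' : β + 2 ^ (e - L) ≤ F.emax) (j : ℕ) (x : Token e) :
    eqWeight t L A β j x ∈ F.permissible := by
  have hA_mem := F.zpow_mem hA hA'
  have hcode := code_lt x.1 (e - L)
  zify at hcode
  unfold eqWeight
  split_ifs
  · exact floatTerm_mem (fun x hx => by rwa [one_mul]) hA_mem hM (by omega) (by omega) _
  · exact hA_mem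

theorem eqValue_mem (hM : 0 < F.M) (hα : -F.emax ≤ α - (t - 1 : ℕ))
    (hα' : α + 2 ^ (e - 1) ≤ F.emax + 1) (hμ : -F.emax ≤ μ - (1 + (t - 3) : ℕ))
    (hμ' : μ + 2 ^ (e - L) ≤ F.emax) (j : ℕ) (x : Token e) :
    eqValue m t L α μ j x ∈ F.permissible := by
  have hupper := code_lt x.1 (e - 1)
  have hlower := code_lt x.1 (e - L)
  have hone (x : ℝ) (hx : x ∈ F.permissible) : 1 * x ∈ F.permissible := by rwa [one_mul]
  have hneg (x : ℝ) (hx : x ∈ F.permissible) : -1 * x ∈ F.permissible := by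
    rw [neg_one_mul]; exact F.neg_mem hx
  zify at hupper hlower
  unfold eqValue
  split_ifs
  · exact floatTerm_mem hneg F.zero_mem F.M.zero_le (by omega) (by omega) _
  · exact F.zero_mem
  · exact floatTerm_mem hone F.zero_mem F.M.zero_le (by omega) (by omega) _
  · exact floatTerm_mem hone F.zero_mem hM (by omega) (by omega) _
  · exact F.zero_mem

end Blocks

section Tokens

variable {m : ℕ}

/-- `tokens`, indexed by the natural numbers. -/
def tokenAt (n t e : ℕ) (y z : Fin m → Bool) (j : ℕ) : Token e :=
  if h : j < n + 1 then tokens n t e y z ⟨j, h⟩ else zeroToken e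

variable {n t e : ℕ} (y z : Fin m → Bool)

theorem tokens_eq_tokenAt (j : Fin (n + 1)) : tokens n t e y z j = tokenAt n t e y z j := by
  rw [tokenAt, dif_pos j.2]

theorem tokenAt_of_lt {j : ℕ} (h : j < n) :
    tokenAt n t e y z j = inputRep n t e y z ⟨j, h⟩ := by
  rw [tokenAt, dif_pos (by omega), tokens_of_lt]

theorem tokenAt_upper_left {i : ℕ} (hi : i < t) (h : i < n) :
    tokenAt n t e y z i = (tuple₁ e y, decide (0 < i) && bit y (e + i - 1)) := by
  rw [tokenAt_of_lt y z h]
  rcases i.eq_zero_or_pos with rfl | hpos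
  · rfl
  · simp (disch := omega) only [inputRep, if_neg, if_pos, decide_eq_true hpos, Bool.true_and]

theorem tokenAt_lower_left {i : ℕ} (hi : i + 1 < t) (h : t + i < n) :
    tokenAt n t e y z (t + i) = (tuple₂ t e y, bit y (t + 2 * e - 2 - lg m + (i + 1))) := by
  rw [tokenAt_of_lt y z h]
  simp (disch := omega) only [inputRep, if_neg, if_pos]
  rw [show t + i - (t - 1) = i + 1 by omega]

theorem tokenAt_upper_right (ht : 2 * t ≤ m) {i : ℕ} (hi : i < t) (h : m + i < n) :
    tokenAt n t e y z (m + i) = (tuple₁ e z, decide (0 < i) && bit z (e + i - 1)) := by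
  rw [tokenAt_of_lt y z h]
  rcases i.eq_zero_or_pos with rfl | hpos
  · simp (disch := omega) only [inputRep, if_neg, if_pos, lt_irrefl, decide_false,
      Bool.false_and]
  · simp (disch := omega) only [inputRep, if_neg, if_pos, decide_eq_true hpos, Bool.true_and,
      Nat.add_sub_cancel_left]

theorem tokenAt_lower_right (ht : 2 * t ≤ m) {i : ℕ} (hi : i + 1 < t) (h : m + t + i < n) :
    tokenAt n t e y z (m + t + i) = (tuple₂ t e z, bit z (t + 2 * e - 2 - lg m + (i + 1))) := by
  rw [tokenAt_of_lt y z h]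
  simp (disch := omega) only [inputRep, if_neg, if_pos]
  rw [show m + t + i - (m + (t - 1)) = i + 1 by omega]

end Tokens

section EqualityTransformer

/-- The upper part of a string, as a float: its first `e - 1` bits are the exponent, relative to
`α`, and the next `t - 1` bits are the fraction. -/
noncomputable def upperFloat {m : ℕ} (α : ℤ) (t e : ℕ) (y : Fin m → Bool) : ℝ :=
  packedFloat α (bitStream y) (e - 1) (t - 1)

/-- The lower part of a string, as a float: the `e - lg m` bits after the upper part are the
exponent, relative to `β`, and the next `t - 2` bits are the fraction. -/
noncomputable def lowerFloat {m : ℕ} (β : ℤ) (t e : ℕ) (y : Fin m → Bool) : ℝ :=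
  packedFloat β (lowerBits t e y) (e - lg m) (t - 2)

theorem lowerFloat_pos {m : ℕ} (β : ℤ) (t e : ℕ) (y : Fin m → Bool) : 0 < lowerFloat β t e y :=
  truncFloat_pos _ _ _

theorem upperFloat_le_upperFloat {m t e : ℕ} (h : e - 1 + (t - 1) ≤ m) (α : ℤ)
    {y z : Fin m → Bool} (hyz : binVal y ≤ binVal z) :
    upperFloat α t e y ≤ upperFloat α t e z := by
  rw [binVal_eq_bitsVal, binVal_eq_bitsVal] at hyz
  exact packedFloat_le_iff.2 (bitsVal_le_of_le h hyz)

theorem eq_of_upperFloat_eq_of_lowerFloat_eq {m t e : ℕ}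
    (hm : m ≤ e - 1 + (t - 1) + (e - lg m + (t - 2))) {α β : ℤ} {y z : Fin m → Bool}
    (hupper : upperFloat α t e y = upperFloat α t e z)
    (hlower : lowerFloat β t e y = lowerFloat β t e z) : y = z := by
  have hupper' := packedFloat_inj.1 hupper
  have hlower' := packedFloat_inj.1 hlower
  funext ⟨i, hi⟩
  rw [← bitStream_of_lt y hi, ← bitStream_of_lt z hi]
  rcases Nat.lt_or_ge i (e - 1 + (t - 1)) with hlt | hge
  · exact eq_of_bitsVal_eq hupper' hlt
  · obtain ⟨i, rfl⟩ := Nat.exists_eq_add_of_le hge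
    exact eq_of_bitsVal_eq hlower' (by omega)

/-- The conditions under which attention with the weights `eqWeight` and the values `eqValue`,
followed by a test for the quotient `2 ^ γ`, computes equality in the format `F`: the tokens carry
all bits of a string, the weights `2 ^ A` are lost in the denominator, and the lower part of the
numerator is negligible against a difference of upper parts. -/
structure EqParams (F : Format) (m n t e : ℕ) (A β μ γ : ℤ) : Prop where
  two_lt : 2 < t
  lg_pos : 0 < lg m
  lg_lt : lg m < e
  two_mul_le : 2 * t ≤ m
  two_mul_le' : 2 * m ≤ n
  upper_le : e - 1 + (t - 1) ≤ m
  le_upper_add_lower : m ≤ e - 1 + (t - 1) + (e - lg m + (t - 2))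
  le_mantissa : t ≤ F.M + 1
  mantissa_le : F.M ≤ F.emax
  upper_exponent_le : (2 : ℤ) ^ (e - 1) ≤ F.emax + 1
  weight_nonpos : A ≤ 0
  noise_le : A + t + F.M + 1 ≤ β
  value_le : μ + 2 ^ (e - lg m) + t ≤ 0
  le_product : -F.emax ≤ A + μ - t
  quotient_nonpos : γ ≤ 0
  lt_quotient : -F.emax < γ
  product_eq : A + μ = β + γ

/-- The Transformer that divides the difference of the two upper parts plus the lower part of `z`
by the lower part of `y`, and tests whether the quotient is `2 ^ γ`. -/
noncomputable def eqTransformer (F : Format) (m n t e : ℕ) (A β μ γ : ℤ) :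
    Transformer (n + 1) (Token e) 3 1 1 2 :=
  testTransformer n (eqWeight t (lg m) A β) (eqValue m t (lg m) 0 μ) γ F.M

/-- The numerator of the last attention quotient of `eqTransformer`: the value of a token times its
weight is again of the form `eqValue`. -/
noncomputable def eqNumerator {m : ℕ} (F : Format) (n t e : ℕ) (A μ : ℤ) (y z : Fin m → Bool) : ℝ :=
  accum F.round (fun j => eqValue m t (lg m) A (A + μ) j (tokenAt n t e y z j)) 0 (n + 1)

namespace EqParams

variable {F : Format} {m n t e : ℕ} {A β μ γ : ℤ}

theorem weight_mem (h : EqParams F m n t e A β μ γ) (j : ℕ) (x : Token e) :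
    eqWeight t (lg m) A β j x ∈ F.permissible := by
  have : (0 : ℤ) < 2 ^ (e - lg m) := by positivity
  obtain ⟨⟩ := h
  exact eqWeight_mem (by omega) (by omega) (by omega) (by omega) (by omega) j x

theorem value_mem (h : EqParams F m n t e A β μ γ) (j : ℕ) (x : Token e) :
    eqValue m t (lg m) 0 μ j x ∈ F.permissible := by
  have : (0 : ℤ) < 2 ^ (e - lg m) := by positivity
  obtain ⟨⟩ := h
  exact eqValue_mem (by omega) (by omega) (by omega) (by omega) (by omega) j x

theorem product_mem (h : EqParams F m n t e A β μ γ) (j : ℕ) (x : Token e) :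
    eqValue m t (lg m) A (A + μ) j x ∈ F.permissible := by
  have : (0 : ℤ) < 2 ^ (e - lg m) := by positivity
  obtain ⟨⟩ := h
  exact eqValue_mem (by omega) (by omega) (by omega) (by omega) (by omega) j x

variable (y z : Fin m → Bool)

theorem floatTerms_weight (h : EqParams F m n t e A β μ γ) :
    FloatTerms (fun i => eqWeight t (lg m) A β (t + i) (tokenAt n t e y z (t + i))) 1 ((2 : ℝ) ^ A)
      (β + bitsVal (lowerBits t e y) (e - lg m)) (fun i => lowerBits t e y (e - lg m + i)) 1
      (t - 3) := by
  obtain ⟨⟩ := h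
  refine FloatTerms.of_eq_floatTerm (b := fun i => bit y (t + 2 * e - 2 - lg m + (i + 1))) le_rfl
    (fun i hi => ?_) fun i _ k hk => bit_eq_bitStream y (by omega)
  rw [eqWeight, if_pos (by omega), tokenAt_lower_left y z (by omega) (by omega),
    code_tuple₂ (by omega) (by omega) (by omega), Nat.add_sub_cancel_left]

theorem denominator_eq (h : EqParams F m n t e A β μ γ) :
    accum F.round (fun j => eqWeight t (lg m) A β j (tokenAt n t e y z j)) 0 (n + 1) =
      lowerFloat β t e y := by
  have hterms := h.floatTerms_weight y z
  have hmem := h.weight_mem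
  have hcode := bitsVal_lt (lowerBits t e y) (e - lg m)
  zify at hcode
  obtain ⟨⟩ := h
  rw [show n + 1 = t + (t - 3 + 1) + (n + 1 - (t + (t - 3 + 1))) by omega,
    accum_eq_truncFloat_of_noise (by omega) (by omega) (by omega) (by omega) (by omega)
      (fun j => hmem j _) (fun i _ => if_neg (by omega)) hterms fun i _ => if_neg (by omega),
    lowerFloat, packedFloat, show 1 + (t - 3) = t - 2 by omega]

theorem numeratorTerms (h : EqParams F m n t e A β μ γ) :
    NumeratorTerms F (fun j => eqValue m t (lg m) A (A + μ) j (tokenAt n t e y z j))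
      (A + bitsVal (bitStream y) (e - 1)) (A + bitsVal (bitStream z) (e - 1))
      (A + μ + bitsVal (lowerBits t e z) (e - lg m)) (fun i => bitStream y (e - 1 + i))
      (fun i => bitStream z (e - 1 + i)) (fun i => lowerBits t e z (e - lg m + i))
      (t - 1) (t - 3) m (n + 1) := by
  have hmem := h.product_mem
  obtain ⟨⟩ := h
  refine ⟨fun j => hmem j _, ?_, fun j hj hjm => ?_, ?_, ?_, fun j hj _ => ?_⟩
  · refine FloatTerms.of_eq_floatTerm (b := fun i => decide (0 < i) && bit y (e + i - 1))
      zero_le_one (fun i hi => ?_) fun i _ k hk => ?_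
    · rw [eqValue, if_pos (by omega), tokenAt_upper_left y z (by omega) (by omega), code_tuple₁]
    · rw [decide_eq_true (by omega), Bool.true_and]
      exact bit_eq_bitStream y (by omega)
  · rw [eqValue, if_neg (by omega), if_pos hjm]
  · refine FloatTerms.of_eq_floatTerm (b := fun i => decide (0 < i) && bit z (e + i - 1))
      zero_le_one (fun i hi => ?_) fun i _ k hk => ?_
    · rw [eqValue, if_neg (by omega), if_neg (by omega), if_pos (by omega),
        tokenAt_upper_right y z (by omega) (by omega) (by omega), code_tuple₁,
        Nat.add_sub_cancel_left]
    · rw [decide_eq_true (by omega), Bool.true_and]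
      exact bit_eq_bitStream z (by omega)
  · refine FloatTerms.of_eq_floatTerm (b := fun i => bit z (t + 2 * e - 2 - lg m + (i + 1)))
      le_rfl (fun i hi => ?_) fun i _ k hk => bit_eq_bitStream z (by omega)
    rw [show m + (t - 1 + 1) + i = m + t + i by omega, eqValue, if_neg (by omega),
      if_neg (by omega), if_neg (by omega), if_pos (by omega),
      tokenAt_lower_right y z (by omega) (by omega) (by omega),
      code_tuple₂ (by omega) (by omega) (by omega), Nat.add_sub_cancel_left]
  · rw [eqValue, if_neg (by omega), if_neg (by omega), if_neg (by omega), if_neg (by omega)]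

variable {y z}

theorem numerator_eq (h : EqParams F m n t e A β μ γ)
    (hyz : upperFloat A t e y = upperFloat A t e z) :
    eqNumerator F n t e A μ y z = (2 : ℝ) ^ γ * lowerFloat β t e z := by
  have hG := h.numeratorTerms y z
  have hupper := bitsVal_lt (bitStream y) (e - 1)
  have hlower := bitsVal_lt (lowerBits t e z) (e - lg m)
  zify at hupper hlower
  obtain ⟨⟩ := h
  rw [eqNumerator, hG.accum_eq (by omega) (by omega) (by omega) (by omega) (by omega) (by omega)
    (by omega) (by omega) hyz, lowerFloat, packedFloat, zpow_mul_truncFloat,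
    show 1 + (t - 3) = t - 2 by omega]
  congr 1
  omega

theorem le_numerator (h : EqParams F m n t e A β μ γ)
    (hyz : upperFloat A t e y < upperFloat A t e z) :
    (2 : ℝ) ^ γ * (lowerFloat β t e y * 2) ≤ eqNumerator F n t e A μ y z := by
  have hG := h.numeratorTerms y z
  have hupper := bitsVal_lt (bitStream y) (e - 1)
  have hupper' := bitsVal_lt (bitStream z) (e - 1)
  have hlower := bitsVal_lt (lowerBits t e y) (e - lg m)
  zify at hupper hupper' hlower
  obtain ⟨⟩ := h
  set κ : ℤ := β + bitsVal (lowerBits t e y) (e - lg m)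
  have hlowerFloat : lowerFloat β t e y ≤ (2 : ℝ) ^ (κ + 1) :=
    (le_add_of_nonneg_right (zpow_nonneg zero_le_two _)).trans (truncFloat_add_zpow_le κ _ _)
  calc (2 : ℝ) ^ γ * (lowerFloat β t e y * 2) ≤ (2 : ℝ) ^ γ * ((2 : ℝ) ^ (κ + 1) * 2) := by gcongr
    _ = (2 : ℝ) ^ (γ + (κ + 2)) := by
        rw [zpow_add₀ two_ne_zero γ, show κ + 2 = κ + 1 + 1 by ring,
          zpow_add_one₀ two_ne_zero (κ + 1)]
    _ ≤ (2 : ℝ) ^ (A + bitsVal (bitStream y) (e - 1) - (t - 1 : ℕ)) :=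
        zpow_le_zpow_right₀ one_le_two (by omega)
    _ ≤ _ := hG.zpow_le_accum (by omega) (by omega) (by omega) (by omega) (by omega) (by omega) hyz

theorem output_eq (h : EqParams F m n t e A β μ γ) (y z : Fin m → Bool) (i : Fin (n + 1)) :
    (eqTransformer F m n t e A β μ γ).output F id (tokens n t e y z) i =
      (eqTransformer F m n t e A β μ γ).mlp F fun _ =>
        F.round (eqNumerator F n t e A μ y z / lowerFloat β t e y) := by
  have hproduct (j : ℕ) (x : Token e) : eqWeight t (lg m) A β j x * eqValue m t (lg m) 0 μ j x =
      eqValue m t (lg m) A (A + μ) j x := by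
    obtain ⟨⟩ := h
    rw [eqWeight_mul_eqValue (by omega), add_zero]
  rw [eqTransformer, testTransformer_output (eqWeight_pos A β) h.weight_mem h.value_mem
    (fun j x => hproduct j x ▸ h.product_mem j x) (tokens_eq_tokenAt y z), h.denominator_eq]
  simp only [hproduct, eqNumerator]

theorem output_eq_one (h : EqParams F m n t e A β μ γ)
    (hyz : upperFloat A t e y = upperFloat A t e z)
    (hyz' : lowerFloat β t e y = lowerFloat β t e z) (i : Fin (n + 1)) (k : Fin 3) :
    (eqTransformer F m n t e A β μ γ).output F id (tokens n t e y z) i k = 1 := by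
  rw [h.output_eq, h.numerator_eq hyz, hyz', mul_div_cancel_right₀ _ (lowerFloat_pos β t e z).ne']
  obtain ⟨⟩ := h
  rw [F.round_eq_self (F.zpow_mem (by omega) (by omega))]
  exact testTransformer_mlp_eq_one (by omega) (by omega) (by omega) k

theorem output_eq_zero (h : EqParams F m n t e A β μ γ) {N : ℝ}
    (hN : eqNumerator F n t e A μ y z = N)
    (hgap : (2 : ℝ) ^ γ * (lowerFloat β t e y * (1 + (2 : ℝ) ^ (-(F.M : ℤ)))) ≤ N ∨
      N ≤ (2 : ℝ) ^ γ * (lowerFloat β t e y * (1 - (2 : ℝ) ^ (-(F.M : ℤ)))))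
    (i : Fin (n + 1)) (k : Fin 3) :
    (eqTransformer F m n t e A β μ γ).output F id (tokens n t e y z) i k = 0 := by
  have hpos := lowerFloat_pos β t e y
  rw [h.output_eq, hN]
  obtain ⟨⟩ := h
  refine testTransformer_mlp_eq_zero (by omega) (by omega) (by omega) (by omega) (F.round_mem _)
    (hgap.imp (fun hle => ?_) fun hle => ?_) k
  · refine F.le_round (F.zpow_mul_one_add_mem (by omega) (by omega) (by omega)) ?_
    rwa [le_div_iff₀' hpos, mul_left_comm]
  · refine F.round_le (F.zpow_mul_one_sub_mem (by omega) (by omega) (by omega)) ?_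
    rwa [div_le_iff₀' hpos, mul_left_comm]

theorem gap_of_lowerFloat_ne (h : EqParams F m n t e A β μ γ)
    (hyz : lowerFloat β t e y ≠ lowerFloat β t e z) :
    lowerFloat β t e y * (1 + (2 : ℝ) ^ (-(F.M : ℤ))) ≤ lowerFloat β t e z ∨
      lowerFloat β t e z ≤ lowerFloat β t e y * (1 - (2 : ℝ) ^ (-(F.M : ℤ))) := by
  have hpos := lowerFloat_pos β t e y
  have hulp : (2 : ℝ) ^ (-(F.M : ℤ)) ≤ (2 : ℝ) ^ (-((t - 2 : ℕ) + 1 : ℤ)) := by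
    obtain ⟨⟩ := h
    exact zpow_le_zpow_right₀ one_le_two (by omega)
  refine hyz.lt_or_gt.imp (fun hlt => ?_) fun hlt => ?_
  · exact (mul_le_mul_of_nonneg_left (by linarith) hpos.le).trans (truncFloat_mul_one_add_le hlt)
  · exact (truncFloat_le_mul_one_sub hlt).trans (mul_le_mul_of_nonneg_left (by linarith) hpos.le)

theorem computesEQOn (h : EqParams F m n t e A β μ γ)
    {R : (Fin m → Bool) → (Fin m → Bool) → Prop} (hR : ∀ y z, R y z → binVal y ≤ binVal z) :
    ComputesEQOn R n t e three_pos (eqTransformer F m n t e A β μ γ) F id := by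
  intro y z hyz
  have hupper : upperFloat A t e y ≤ upperFloat A t e z :=
    upperFloat_le_upperFloat h.upper_le A (hR y z hyz)
  rcases hupper.lt_or_eq with hlt | heq
  · rw [if_neg (by rintro rfl; exact hlt.false)]
    refine h.output_eq_zero rfl (Or.inl (le_trans ?_ (h.le_numerator hlt))) _ _
    have hpos := lowerFloat_pos β t e y
    have hulp : (2 : ℝ) ^ (-(F.M : ℤ)) ≤ 1 := zpow_le_one_of_nonpos₀ one_le_two (by omega)
    gcongr
    linarith
  · by_cases hlower : lowerFloat β t e y = lowerFloat β t e z
    · rw [if_pos (eq_of_upperFloat_eq_of_lowerFloat_eq h.le_upper_add_lower heq hlower)]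
      exact h.output_eq_one heq hlower _ _
    · rw [if_neg (by rintro rfl; exact hlower rfl)]
      refine h.output_eq_zero (h.numerator_eq heq) ((h.gap_of_lowerFloat_ne hlower).imp ?_ ?_) _ _
      · exact fun hle => mul_le_mul_of_nonneg_left hle (zpow_nonneg zero_le_two _)
      · exact fun hle => mul_le_mul_of_nonneg_left hle (zpow_nonneg zero_le_two _)

end EqParams

end EqualityTransformer

section Parameters

variable {m t e : ℕ}

theorem le_two_pow_lg (m : ℕ) : (m + 1) / 2 ≤ 2 ^ lg m := Nat.le_pow_clog one_lt_two _

theorem lg_le (m : ℕ) : lg m ≤ (m + 1) / 2 :=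
  Nat.clog_le_of_le_pow Nat.lt_two_pow_self.le

theorem three_le_lg (hm : 6 ≤ (m + 1) / 2) : 3 ≤ lg m :=
  (Nat.lt_clog_iff_pow_lt one_lt_two).2 (by omega)

theorem exists_admissible (hm : 6 ≤ (m + 1) / 2) : ∃ t e, Admissible m t e :=
  ⟨(m + 1) / 2 - 3, lg m + 3, by omega, by omega, by omega⟩

theorem Admissible.exists_eqParams {n : ℕ} (h : Admissible m t e)
    (hcover : m + lg m + 4 ≤ 2 * (t + e)) (hn : 2 * m ≤ n) {F : Format} (ht : t ≤ F.M + 1)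
    (ht' : F.M ≤ t) (he : e ≤ F.B + 1) : ∃ A β μ γ, EqParams F m n t e A β μ γ := by
  obtain ⟨hte, hlg, ht2⟩ := h
  have := lg_le m
  have hm := le_two_pow_lg m
  have hlg_pow : 2 ^ lg m ≤ 2 ^ (e - 3) := Nat.pow_le_pow_right two_pos (by omega)
  have hrange : 2 ^ (e - lg m) ≤ 2 ^ (e - 3) := Nat.pow_le_pow_right two_pos (by omega)
  have he_pow : 2 ^ (e - 1) = 4 * 2 ^ (e - 3) := by
    rw [show e - 1 = 2 + (e - 3) by omega, pow_add]; rfl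
  have hrange_pos : 0 < 2 ^ (e - lg m) := by positivity
  have hemax : 2 ^ (e - 1) ≤ 2 ^ F.B := Nat.pow_le_pow_right two_pos (by omega)
  zify at hlg_pow hrange he_pow hrange_pos hemax hm
  exact ⟨2 ^ (e - lg m) + 2 * t - F.emax, 2 ^ (e - lg m) + 3 * t + F.M + 1 - F.emax,
    -(2 ^ (e - lg m) + t), -(2 ^ (e - lg m) + 2 * t + F.M + 1), by
    constructor <;> (try simp only [Format.emax]) <;> omega⟩

end Parameters

end FPTransformer

open FPTransformer in
theorem theoremC2_general {m n t e : ℕ} (h : Admissible m t e)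
    (hcover : m + lg m + 4 ≤ 2 * (t + e)) (hn : 2 * m ≤ n)
    {R : (Fin m → Bool) → (Fin m → Bool) → Prop} (hR : ∀ y z, R y z → binVal y ≤ binVal z)
    (hR' : ∀ y z, binVal y ≤ binVal z → bit z 1 = false → R y z) :
    (∀ (F : Format) (dv : ℕ), (dv + 1) * F.bits < m → ∀ (σ : ℝ → ℝ) (d dq dff : ℕ) (hd : 0 < d)
      (T : Transformer (n + 1) (Token e) d dq dv dff), ¬ ComputesEQOn R n t e hd T F σ) ∧
    (∃ F : Format, F.M + 1 = t ∧ F.B + 1 = e ∧ F.bits = (m + 1) / 2 + lg m ∧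
      ∃ (d dq dff : ℕ) (hd : 0 < d) (T : Transformer (n + 1) (Token e) d dq 1 dff),
        ComputesEQOn R n t e hd T F id) ∧
    (∃ F : Format, F.M = t ∧ F.B = e ∧ F.bits = (m + 1) / 2 + lg m + 2 ∧
      ∃ (d dq dff : ℕ) (hd : 0 < d) (T : Transformer (n + 1) (Token e) d dq 1 dff),
        ComputesEQOn R n t e hd T F id) := by
  have := lg_le m
  have hcomputes (F : Format) (hM : t ≤ F.M + 1) (hM' : F.M ≤ t) (hB : e ≤ F.B + 1) :
      ∃ (d dq dff : ℕ) (hd : 0 < d) (T : Transformer (n + 1) (Token e) d dq 1 dff),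
        ComputesEQOn R n t e hd T F id := by
    obtain ⟨A, β, μ, γ, hparams⟩ := h.exists_eqParams hcover hn hM hM' hB
    exact ⟨3, 1, 2, three_pos, eqTransformer F m n t e A β μ γ, hparams.computesEQOn hR⟩
  obtain ⟨hte, hlg_lt, ht⟩ := h
  refine ⟨fun F dv hF σ d dq dff hd T =>
    not_computesEQOn hR' (by omega) (by omega) (by omega) hF σ hd T,
    ⟨⟨t - 1, e - 1⟩, by simp only; omega, by simp only; omega, by simp only [Format.bits]; omega,
      hcomputes _ (by simp only; omega) (by simp only; omega) (by simp only; omega)⟩,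
    ⟨⟨t, e⟩, rfl, rfl, by simp only [Format.bits]; omega,
      hcomputes _ (by simp only; omega) le_rfl (by simp only; omega)⟩⟩

open FPTransformer in
theorem theoremC2 (p n m : ℕ) (hp : 6 ≤ p) (hn : 4 * p < n) (hm : m = 2 * p - 1) :
    (∃ t e : ℕ, Admissible m t e) ∧
    ∀ t e : ℕ, Admissible m t e →
      -- at most `p - 1` bits do not suffice, in whatever arithmetic the scores are computed
      (∀ F : Format, F.bits ≤ p - 1 → ∀ (σ : ℝ → ℝ) (d dq dff : ℕ) (hd : 0 < d)
        (T : Transformer (n + 1) (Token e) d dq 1 dff), ¬ ComputesEQ m n t e hd T F σ) ∧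
      -- `p + log p` bits suffice, `t` for the signed mantissa and `e` for the signed exponent
      (∃ F : Format, F.M + 1 = t ∧ F.B + 1 = e ∧ F.bits = p + Nat.clog 2 p ∧
        ∃ (d dq dff : ℕ) (hd : 0 < d) (T : Transformer (n + 1) (Token e) d dq 1 dff),
          ComputesEQ m n t e hd T F id) ∧
      -- `p + log p + 2` bits suffice, where the two sign bits are counted in addition to `t + e`
      (∃ F : Format, F.M = t ∧ F.B = e ∧ F.bits = p + Nat.clog 2 p + 2 ∧
        ∃ (d dq dff : ℕ) (hd : 0 < d) (T : Transformer (n + 1) (Token e) d dq 1 dff),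
          ComputesEQ m n t e hd T F id) := by
  obtain rfl : p = (m + 1) / 2 := by omega
  refine ⟨exists_admissible hp, fun t e h => ?_⟩
  have hcover : m + lg m + 4 ≤ 2 * (t + e) := by have := three_le_lg hp; have := h.1; omega
  exact (theoremC2_general h hcover (by omega) (R := Promise e) (fun _ _ hyz => hyz.1)
    fun _ _ hyz hz => ⟨hyz, 1, le_rfl, by have := h.2.1; omega, hz⟩).imp_left
      fun hlower F hF => hlower F 1 (by omega)
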